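/- Let $X$ be a locally compact Polish space and let $\mathbb K(X)$ be the cone of discrete Radon measures $\eta=\sum_{i}s_i\delta_{x_i}$ on $X$ (at most countably many distinct atoms $x_i\in X$, weights $s_i>0$, $\eta(\Lambda)<\infty$ for compact $\Lambda$), with the Borel $\sigma$-algebra of the vague topology. Put $\tau(\eta)=\{x:\eta(\{x\})>0\}$, $s_x=\eta(\{x\})$, $\hat X=(0,\infty)\times X$. Let $\Gamma(\hat X)$ be the space of locally finite configurations in $\hat X$ (subsets with finitely many points in each compact set), with the Borel $\sigma$-algebra of the vague topology, and let $\Pi(\hat X)\subset\Gamma(\hat X)$ be the set of those $\gamma$ that contain at most one point $(s,x)$ over each $x\in X$ and satisfy $\sum_{(s,x)\in\gamma}s\mathbf 1_\Lambda(x)<\infty$ for all relatively compact Borel $\Lambda\subset X$. Let $\mathcal R:\Pi(\hat X)\to\mathbb K(X)$, $\mathcal R\gamma=\sum_{(s,x)\in\gamma}s\delta_x$; this is a bijection with inverse $\mathcal R^{-1}\eta=\{(s_x,x):x\in\tau(\eta)\}$. Let $\nu$ and $\sigma$ be non-atomic positive Radon measures on $(0,\infty)$ and $X$ with $\int s\,d\nu(s)<\infty$.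 Let $\pi_{\nu\otimes\sigma}$ be the Poisson measure on $\Gamma(\hat X)$ with intensity $\nu\otimes\sigma$, i.e. the probability measure with $\int e^{-\langle\gamma,f\rangle}d\pi_{\nu\otimes\sigma}(\gamma)=\exp\int(e^{-f}-1)\,d(\nu\otimes\sigma)$ for all $0\le f\in C_c(\hat X)$, where $\langle\gamma,f\rangle=\sum_{y\in\gamma}f(y)$. Let $\mu=\pi_{\mathbb K,\nu\otimes\sigma}$ be the push-forward under $\mathcal R$ of $\pi_{\nu\otimes\sigma}$, viewed as a measure on $\Pi(\hat X)$. Let $\mathcal F$ be the set of all functions $F(\eta)=g(\langle\mathcal R^{-1}\eta,\varphi_1\rangle,\dots,\langle\mathcal R^{-1}\eta,\varphi_N\rangle)$ on $\mathbb K(X)$ with $N\in\mathbb N$, $g\in C_b(\mathbb R^N)$, $\varphi_i\in C_c(\hat X)$. For $F,G\in\mathcal F$ put $(D^-_xF)(\eta)=F(\eta-s_x\delta_x)-F(\eta)$, $(D^+_{(s,x)}F)(\eta)=F(\eta+s\delta_x)-F(\eta)$, $$\mathcal E(F,G)=\int_{\mathbb K(X)}\int_X(D^-_xF)(\eta)(D^-_xG)(\eta)\,d\eta(x)\,d\mu(\eta),$$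 $$(LF)(\eta)=\int_X(D^-_xF)(\eta)\,d\eta(x)+\int_X\int_{(0,\infty)}(D^+_{(s,x)}F)(\eta)\,s\,d\nu(s)\,d\sigma(x).$$ Then $\mu$ is a probability measure, all these integrals exist, $F,LF\in L^2(\mathbb K(X),\mu)$ for $F\in\mathcal F$, and $L$ and $\mathcal E$ are well defined on $\mu$-classes of functions in $\mathcal F$. Moreover: (i) $(L,\mathcal F)$ is a densely defined symmetric operator on $L^2(\mathbb K(X),\mu)$, and $\mathcal E(F,G)=\langle -LF,G\rangle_{L^2(\mu)}$ for all $F,G\in\mathcal F$. (ii) The symmetric non-negative form $(\mathcal E,\mathcal F)$ is closable on $L^2(\mathbb K(X),\mu)$; its closure $(\mathcal E,D(\mathcal E))$ is a closed symmetric form. (iii) $(L,\mathcal F)$ has a Friedrichs extension $(L,D(L))$, i.e. $(-L,D(L))$ is a self-adjoint extension of the non-negative operator $(-L,\mathcal F)$ whose domain lies in the domain of the closure of the form $(u,v)\mapsto\langle -Lu,v\rangle$ on $\mathcal F$; and $(L,D(L))$ is the generator of $(\mathcal E,D(\mathcal E))$: $u\in D(L)$ and $Lu=w$ if and only if $u\in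 D(\mathcal E)$ and $\mathcal E(u,v)=\langle -w,v\rangle$ for all $v\in D(\mathcal E)$. -/

import Mathlib

open MeasureTheory Filter Topology Set
open scoped ENNReal CompactlySupported BoundedContinuousFunction InnerProductSpace

noncomputable section

namespace ConeCalculus

/-! ### Locally finite configurations and Poisson measures -/

/-- Locally finite configurations in `Y`: subsets with finitely many points in each compact set. -/
@[ext]
structure Configuration (Y : Type*) [TopologicalSpace Y] where
  carrier : Set Y
  locallyFinite : ∀ K : Set Y, IsCompact K → (carrier ∩ K).Finite

namespace Configuration

variable {Y : Type*} [TopologicalSpace Y]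

/-- `⟨γ, f⟩ = ∑_{y ∈ γ} f y` (a sum with finitely many non-zero terms for `f ∈ C_c`). -/
def pairing (γ : Configuration Y) (f : C_c(Y, ℝ)) : ℝ := ∑' y : γ.carrier, f y

/-- The vague topology on configurations. -/
instance : TopologicalSpace (Configuration Y) :=
  TopologicalSpace.induced (fun γ (f : C_c(Y, ℝ)) => γ.pairing f) inferInstance

/-- The Borel `σ`-algebra of the vague topology. -/
instance : MeasurableSpace (Configuration Y) := borel _

instance : BorelSpace (Configuration Y) := ⟨rfl⟩

theorem countable [SigmaCompactSpace Y] (γ : Configuration Y) : γ.carrier.Countable := by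
  have h : γ.carrier = ⋃ n, γ.carrier ∩ compactCovering Y n := by
    rw [← inter_iUnion, iUnion_compactCovering, inter_univ]
  rw [h]
  exact countable_iUnion fun n => (γ.locallyFinite _ (isCompact_compactCovering Y n)).countable

end Configuration

/-- `π` is the Poisson measure with intensity `μ` on the configurations in `Y`: the probability
measure with Laplace transform `∫ exp (-⟨γ, f⟩) dπ(γ) = exp (∫ (exp (-f) - 1) dμ)` for all
non-negative continuous compactly supported `f`. -/
structure IsPoissonMeasure {Y : Type*} [TopologicalSpace Y] [MeasurableSpace Y]
    (μ : Measure Y) (π : Measure (Configuration Y)) : Prop where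
  isProbabilityMeasure : IsProbabilityMeasure π
  laplace : ∀ f : C_c(Y, ℝ), (∀ y, 0 ≤ f y) →
    ∫ γ, Real.exp (-γ.pairing f) ∂π = Real.exp (∫ y, (Real.exp (-f y) - 1) ∂μ)

/-! ### The cone of discrete Radon measures -/

variable {X : Type*} [TopologicalSpace X] [MeasurableSpace X]

/-- The cone `𝕂(X)` of non-negative discrete Radon measures on `X`: the measures
`∑_{x ∈ S} s_x δ_x` with `S` countable and `s_x > 0` that are finite on compact sets. -/
@[ext]
structure Cone (X : Type*) [TopologicalSpace X] [MeasurableSpace X] where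
  toMeasure : Measure X
  finite_of_isCompact : ∀ K : Set X, IsCompact K → toMeasure K < ∞
  discrete : ∃ (S : Set X) (s : S → ℝ), S.Countable ∧ (∀ x, 0 < s x) ∧
    toMeasure = Measure.sum fun x : S => ENNReal.ofReal (s x) • Measure.dirac (x : X)

/-- The vague topology on `𝕂(X)`: the coarsest one making `η ↦ ∫ f dη` continuous for all
`f ∈ C_c(X)`. -/
instance : TopologicalSpace (Cone X) :=
  TopologicalSpace.induced (fun η (f : C_c(X, ℝ)) => ∫ x, f x ∂η.toMeasure) inferInstance

/-- The Borel `σ`-algebra of the vague topology. -/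
instance : MeasurableSpace (Cone X) := borel _

instance : BorelSpace (Cone X) := ⟨rfl⟩

section Discrete

variable [MeasurableSingletonClass X]

/-- A measure that does not charge the complement of a countable set, and whose atoms have finite
mass, is a countable sum of weighted Dirac measures. -/
theorem exists_discrete (η : Measure X) (h1 : ∀ x, η {x} < ∞) (S : Set X) (hS : S.Countable)
    (h0 : η Sᶜ = 0) : ∃ (S : Set X) (s : S → ℝ), S.Countable ∧ (∀ x, 0 < s x) ∧
      η = Measure.sum fun x : S => ENNReal.ofReal (s x) • Measure.dirac (x : X) := by
  set T : Set X := {x ∈ S | η {x} ≠ 0} with hT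
  have hTc : T.Countable := hS.mono fun x hx => hx.1
  have hT0 : η Tᶜ = 0 := by
    have hsub : Tᶜ ⊆ Sᶜ ∪ ⋃ x ∈ S \ T, {x} := by
      intro x hx
      by_cases hxS : x ∈ S
      · exact Or.inr (mem_biUnion (show x ∈ S \ T from ⟨hxS, hx⟩) rfl)
      · exact Or.inl hxS
    refine measure_mono_null hsub (measure_union_null h0 ?_)
    rw [measure_biUnion_null_iff (hS.mono sdiff_subset)]
    rintro x ⟨hxS, hxT⟩
    by_contra h
    exact hxT ⟨hxS, h⟩
  refine ⟨T, fun x => (η {(x : X)}).toReal, hTc,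
    fun x => ENNReal.toReal_pos x.2.2 (h1 _).ne, Measure.ext fun A hA => ?_⟩
  have hA' : η A = η (A ∩ T) := (measure_inter_conull hT0).symm
  have hU : A ∩ T = ⋃ x ∈ T, A ∩ {x} := by ext; simp
  rw [hA', hU, measure_biUnion hTc, Measure.sum_apply _ hA]
  · refine tsum_congr fun x => ?_
    rw [ENNReal.ofReal_toReal (h1 _).ne, Measure.smul_apply, Measure.dirac_apply' _ hA, smul_eq_mul]
    by_cases hx : (x : X) ∈ A
    · rw [inter_eq_right.2 (singleton_subset_iff.2 hx)]; simp [hx]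
    · have : A ∩ {(x : X)} = ∅ := by simpa using hx
      rw [this]; simp [hx]
  · intro x _ y _ hxy
    exact Disjoint.mono inter_subset_right inter_subset_right (disjoint_singleton.2 hxy)
  · exact fun x _ => hA.inter (measurableSet_singleton x)

theorem Cone.exists_countable (η : Cone X) : ∃ S : Set X, S.Countable ∧ η.toMeasure Sᶜ = 0 := by
  obtain ⟨S, s, hS, -, h⟩ := η.discrete
  refine ⟨S, hS, ?_⟩
  rw [h, Measure.sum_apply _ hS.measurableSet.compl]
  simp [Measure.dirac_apply' _ hS.measurableSet.compl]

theorem Cone.singleton_lt_top (η : Cone X) (x : X) : η.toMeasure {x} < ∞ :=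
  η.finite_of_isCompact _ isCompact_singleton

/-- `η - s_x δ_x`: the measure `η` with its atom at `x` (if any) removed. -/
def Cone.remove (η : Cone X) (x : X) : Cone X where
  toMeasure := η.toMeasure.restrict {x}ᶜ
  finite_of_isCompact K hK :=
    (Measure.restrict_apply_le _ _).trans_lt (η.finite_of_isCompact K hK)
  discrete := by
    obtain ⟨S, hS, h⟩ := η.exists_countable
    exact exists_discrete _
      (fun y => (Measure.restrict_apply_le _ _).trans_lt (η.singleton_lt_top y)) S hS
      (le_antisymm ((Measure.restrict_apply_le _ _).trans h.le) bot_le)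

/-- The measure `η - s_x δ_x` is characterised by `(η - s_x δ_x) + s_x δ_x = η`. -/
theorem Cone.remove_add (η : Cone X) (x : X) :
    (η.remove x).toMeasure + η.toMeasure {x} • Measure.dirac x = η.toMeasure := by
  rw [← Measure.restrict_singleton, add_comm]
  exact Measure.restrict_add_restrict_compl (measurableSet_singleton x)

/-- `η + s δ_x`. -/
def Cone.add (η : Cone X) (s : Ioi (0 : ℝ)) (x : X) : Cone X where
  toMeasure := η.toMeasure + ENNReal.ofReal s • Measure.dirac x
  finite_of_isCompact K hK := by
    rw [Measure.add_apply, Measure.smul_apply, smul_eq_mul]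
    exact ENNReal.add_lt_top.2 ⟨η.finite_of_isCompact K hK,
      ENNReal.mul_lt_top ENNReal.ofReal_lt_top (measure_lt_top _ _)⟩
  discrete := by
    obtain ⟨S, hS, h⟩ := η.exists_countable
    refine exists_discrete _ (fun y => ?_) (S ∪ {x}) (hS.union (countable_singleton x)) ?_
    · rw [Measure.add_apply, Measure.smul_apply, smul_eq_mul]
      exact ENNReal.add_lt_top.2 ⟨η.singleton_lt_top y,
        ENNReal.mul_lt_top ENNReal.ofReal_lt_top (measure_lt_top _ _)⟩
    · have h2 : (S ∪ {x})ᶜ ⊆ Sᶜ := compl_subset_compl.2 subset_union_left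
      rw [Measure.add_apply, measure_mono_null h2 h, Measure.smul_apply]
      simp

end Discrete

/-! ### Pinpointing configurations and the bijection `ℛ` -/

/-- `X̂ = (0, ∞) × X`. -/
abbrev Marked (X : Type*) := Ioi (0 : ℝ) × X

instance : LocallyCompactSpace (Ioi (0 : ℝ)) := isOpen_Ioi.locallyCompactSpace

/-- `∑_{(s,x) ∈ γ} s δ_x`. -/
def markedSum (γ : Set (Marked X)) : Measure X :=
  Measure.sum fun p : γ => ENNReal.ofReal p.1.1 • Measure.dirac p.1.2

/-- The local mass `γ(Λ) = ∑_{(s,x) ∈ γ} s 1_Λ(x)`. -/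
def localMass (γ : Set (Marked X)) (Λ : Set X) : ℝ≥0∞ :=
  ∑' p : γ, Λ.indicator (fun _ => ENNReal.ofReal p.1.1) p.1.2

/-- The set `Π(X̂)` of pinpointing configurations (no two distinct points over the same `x`) with
finite local mass. -/
def pinpointing (X : Type*) [TopologicalSpace X] [MeasurableSpace X] :
    Set (Configuration (Marked X)) :=
  {γ | (∀ p ∈ γ.carrier, ∀ q ∈ γ.carrier, p.2 = q.2 → p.1 = q.1) ∧
    ∀ Λ : Set X, MeasurableSet Λ → IsCompact (closure Λ) → localMass γ.carrier Λ < ∞}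

theorem markedSum_apply (γ : Set (Marked X)) {Λ : Set X} (hΛ : MeasurableSet Λ) :
    markedSum γ Λ = localMass γ Λ := by
  rw [markedSum, localMass, Measure.sum_apply _ hΛ]
  refine tsum_congr fun p => ?_
  rw [Measure.smul_apply, Measure.dirac_apply' _ hΛ, smul_eq_mul]
  by_cases hx : p.1.2 ∈ Λ <;> simp [hx]

section Bijection

variable [T2Space X] [BorelSpace X]

/-- The set `{(s_x, x) : x ∈ τ(η)}`, where `s_x = η({x})` and `τ(η) = {x : s_x > 0}`. -/
def Cone.atomSet (η : Cone X) : Set (Marked X) :=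
  {p | η.toMeasure {p.2} = ENNReal.ofReal p.1}

theorem Cone.markedSum_atomSet (η : Cone X) : markedSum η.atomSet = η.toMeasure := by
  obtain ⟨S, s, hS, hs, h⟩ := η.discrete
  have hmass : ∀ x : S, η.toMeasure {(x : X)} = ENNReal.ofReal (s x) := by
    intro x
    rw [h, Measure.sum_apply _ (measurableSet_singleton _), tsum_eq_single x]
    · simp
    · intro y hy
      have : (y : X) ≠ x := fun h => hy (Subtype.ext h)
      simp [this]
  have hmem : ∀ x, η.toMeasure {x} ≠ 0 → x ∈ S := by
    intro x hx
    by_contra hxS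
    apply hx
    rw [h, Measure.sum_apply _ (measurableSet_singleton _), ENNReal.tsum_eq_zero]
    intro y
    have : (y : X) ≠ x := fun h => hxS (h ▸ y.2)
    simp [this]
  have hmemA : ∀ p : η.atomSet, p.1.2 ∈ S := fun p => hmem _ (by
    rw [show η.toMeasure {p.1.2} = _ from p.2]
    exact (ENNReal.ofReal_pos.2 p.1.1.2).ne')
  let e : S ≃ η.atomSet :=
    { toFun := fun x => ⟨(⟨s x, hs x⟩, x), hmass x⟩
      invFun := fun p => ⟨p.1.2, hmemA p⟩
      left_inv := fun x => rfl
      right_inv := fun p => by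
        refine Subtype.ext (Prod.ext (Subtype.ext ?_) rfl)
        have h1 := hmass ⟨p.1.2, hmemA p⟩
        rw [show η.toMeasure {p.1.2} = _ from p.2] at h1
        exact ((ENNReal.ofReal_eq_ofReal_iff (le_of_lt p.1.1.2) (hs _).le).1 h1).symm }
  refine Measure.ext fun A hA => ?_
  conv_rhs => rw [h]
  rw [markedSum, Measure.sum_apply _ hA, Measure.sum_apply _ hA, ← e.tsum_eq]
  rfl

/-- `{(s_x, x) : x ∈ τ(η)}` as a configuration. -/
def Cone.atoms (η : Cone X) : Configuration (Marked X) where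
  carrier := η.atomSet
  locallyFinite K hK := by
    rcases K.eq_empty_or_nonempty with rfl | hne
    · simp
    obtain ⟨q, -, hq⟩ := hK.exists_isMinOn hne
      (f := fun p : Marked X => (p.1 : ℝ)) (by fun_prop)
    have hfin : {x : Prod.snd '' K | ENNReal.ofReal q.1 ≤ η.toMeasure {(x : X)}}.Finite := by
      refine Measure.finite_const_le_meas_of_disjoint_iUnion η.toMeasure
        (ENNReal.ofReal_pos.2 q.1.2) (fun x => measurableSet_singleton _) ?_ ?_
      · exact fun x y hxy => disjoint_singleton.2 fun h => hxy (Subtype.ext h)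
      · refine ((measure_mono ?_).trans_lt
          (η.finite_of_isCompact _ (hK.image continuous_snd))).ne
        exact iUnion_subset fun x => singleton_subset_iff.2 x.2
    refine Set.Finite.of_finite_image (f := Prod.snd)
      ((hfin.image Subtype.val).subset ?_) ?_
    · rintro _ ⟨p, ⟨hp, hpK⟩, rfl⟩
      refine ⟨⟨p.2, mem_image_of_mem _ hpK⟩, ?_, rfl⟩
      rw [mem_ofPred_eq, show η.toMeasure {p.2} = _ from hp]
      exact ENNReal.ofReal_le_ofReal (hq hpK)
    · rintro p ⟨hp, -⟩ p' ⟨hp', -⟩ h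
      refine Prod.ext (Subtype.ext ?_) h
      have hp : η.toMeasure {p.2} = _ := hp
      have hp' : η.toMeasure {p'.2} = _ := hp'
      rw [h, hp'] at hp
      exact ((ENNReal.ofReal_eq_ofReal_iff (le_of_lt p'.1.2) (le_of_lt p.1.2)).1 hp).symm

theorem Cone.atoms_mem (η : Cone X) : η.atoms ∈ pinpointing X := by
  refine ⟨fun p hp p' hp' h => Subtype.ext ?_, fun Λ hΛ hc => ?_⟩
  · have hp : η.toMeasure {p.2} = _ := hp
    have hp' : η.toMeasure {p'.2} = _ := hp'
    rw [h, hp'] at hp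
    exact ((ENNReal.ofReal_eq_ofReal_iff (le_of_lt p'.1.2) (le_of_lt p.1.2)).1 hp).symm
  · rw [← markedSum_apply _ hΛ]
    change markedSum η.atomSet Λ < ∞
    rw [η.markedSum_atomSet]
    exact (measure_mono subset_closure).trans_lt (η.finite_of_isCompact _ hc)

variable [SecondCountableTopology X] [LocallyCompactSpace X]

/-- `ℛ γ = ∑_{(s,x) ∈ γ} s δ_x` for `γ ∈ Π(X̂)`. -/
def toCone (γ : pinpointing X) : Cone X where
  toMeasure := markedSum γ.1.carrier
  finite_of_isCompact K hK := by
    rw [markedSum_apply _ hK.measurableSet]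
    exact γ.2.2 K hK.measurableSet (by rwa [hK.isClosed.closure_eq])
  discrete := by
    have hinj : InjOn Prod.snd γ.1.carrier :=
      fun p hp q hq h => Prod.ext (γ.2.1 p hp q hq h) h
    let e := hinj.bijOn_image.equiv
    refine ⟨Prod.snd '' γ.1.carrier, fun x => (e.symm x).1.1, γ.1.countable.image _,
      fun x => (e.symm x).1.1.2, Measure.ext fun A hA => ?_⟩
    rw [markedSum, Measure.sum_apply _ hA, Measure.sum_apply _ hA, ← e.tsum_eq]
    refine tsum_congr fun p => ?_
    change _ = (ENNReal.ofReal (e.symm (e p)).1.1 • Measure.dirac ((e p : X))) A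
    rw [e.symm_apply_apply]
    rfl

/-- The bijection `ℛ : Π(X̂) → 𝕂(X)`, `∑ δ_{(s,x)} ↦ ∑ s δ_x`, with inverse
`η ↦ {(s_x, x) : x ∈ τ(η)}`. -/
def bijR : pinpointing X ≃ Cone X where
  toFun := toCone
  invFun η := ⟨η.atoms, η.atoms_mem⟩
  left_inv γ := by
    refine Subtype.ext (Configuration.ext ?_)
    have key : ∀ p ∈ γ.1.carrier, markedSum γ.1.carrier {p.2} = ENNReal.ofReal p.1 := by
      intro p hp
      rw [markedSum, Measure.sum_apply _ (measurableSet_singleton _), tsum_eq_single ⟨p, hp⟩]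
      · simp
      · intro q hq
        have : q.1.2 ≠ p.2 := fun h =>
          hq (Subtype.ext (Prod.ext (γ.2.1 _ q.2 _ hp h) h))
        simp [this]
    ext p
    change markedSum γ.1.carrier {p.2} = ENNReal.ofReal p.1 ↔ _
    refine ⟨fun h => ?_, key p⟩
    by_cases hq : ∃ q ∈ γ.1.carrier, q.2 = p.2
    · obtain ⟨q, hq, hqp⟩ := hq
      rw [← hqp, key q hq,
        ENNReal.ofReal_eq_ofReal_iff (le_of_lt q.1.2) (le_of_lt p.1.2)] at h
      rwa [← show q = p from Prod.ext (Subtype.ext h) hqp]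
    · exfalso
      have h0 : markedSum γ.1.carrier {p.2} = 0 := by
        rw [markedSum, Measure.sum_apply _ (measurableSet_singleton _), ENNReal.tsum_eq_zero]
        intro q
        have : q.1.2 ≠ p.2 := fun h => hq ⟨q.1, q.2, h⟩
        simp [this]
      rw [h0] at h
      exact (ENNReal.ofReal_pos.2 p.1.2).ne h
  right_inv η := Cone.ext η.markedSum_atomSet

/-- The push-forward to `𝕂(X)` under `ℛ` of a measure `π` on configurations, viewed as a measure on
`Π(X̂)`; for `π` the Poisson measure with intensity `ν ⊗ σ` this is `π_{𝕂,ν⊗σ}`. -/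
def coneMeasure (π : Measure (Configuration (Marked X))) : Measure (Cone X) :=
  (π.comap (Subtype.val : pinpointing X → Configuration (Marked X))).map bijR

/-- Cylinder functions on `𝕂(X)`: `F(η) = g(⟨ℛ⁻¹η, φ₁⟩, …, ⟨ℛ⁻¹η, φ_N⟩)` with `g` continuous and
bounded on `ℝ^N` and `φ₁, …, φ_N ∈ C_c(X̂)`. -/
def cylinder (X : Type*) [TopologicalSpace X] [MeasurableSpace X] [T2Space X] [BorelSpace X]
    [SecondCountableTopology X] [LocallyCompactSpace X] : Set (Cone X → ℝ) :=
  {F | ∃ (N : ℕ) (g : (Fin N → ℝ) →ᵇ ℝ) (φ : Fin N → C_c(Marked X, ℝ)),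
    ∀ η, F η = g fun i => (bijR.symm η).1.pairing (φ i)}

end Bijection

/-! ### Discrete gradients, the Dirichlet integral and the birth-and-death operator -/

section Gradients

variable [MeasurableSingletonClass X]

/-- The death gradient `D⁻_x F (η) = F(η - s_x δ_x) - F(η)`. -/
def deathGrad (F : Cone X → ℝ) (η : Cone X) (x : X) : ℝ := F (η.remove x) - F η

/-- The birth gradient `D⁺_{(s,x)} F (η) = F(η + s δ_x) - F(η)`. -/
def birthGrad (F : Cone X → ℝ) (η : Cone X) (p : Marked X) : ℝ := F (η.add p.1 p.2) - F η

/-- `ℰ(F, G) = ∫ ∫ (D⁻_x F)(η) (D⁻_x G)(η) dη(x) dμ(η)`. -/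
def dirichletForm (μ : Measure (Cone X)) (F G : Cone X → ℝ) : ℝ :=
  ∫ η, ∫ x, deathGrad F η x * deathGrad G η x ∂η.toMeasure ∂μ

/-- `(LF)(η) = ∫ (D⁻_x F)(η) dη(x) + ∫ ∫ (D⁺_{(s,x)} F)(η) s dν(s) dσ(x)`. -/
def birthDeath (ν : Measure (Ioi (0 : ℝ))) (σ : Measure X) (F : Cone X → ℝ) (η : Cone X) : ℝ :=
  ∫ x, deathGrad F η x ∂η.toMeasure + ∫ x, ∫ s, birthGrad F η (s, x) * (s : ℝ) ∂ν ∂σ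

end Gradients

/-! ### Bilinear forms and Friedrichs extensions in a real Hilbert space -/

section Forms

variable {H : Type*} [NormedAddCommGroup H] [InnerProductSpace ℝ H]

/-- A bilinear form on a linear subspace of `H`. -/
structure PartialForm (H : Type*) [NormedAddCommGroup H] [InnerProductSpace ℝ H] where
  domain : Submodule ℝ H
  form : domain →ₗ[ℝ] domain →ₗ[ℝ] ℝ

namespace PartialForm

/-- `u n → x` in `H`, and `u` is Cauchy with respect to the form `q`. -/
def Approximates (q : PartialForm H) (u : ℕ → q.domain) (x : H) : Prop :=
  Tendsto (fun n => (u n : H)) atTop (𝓝 x) ∧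
    ∀ ε > 0, ∃ N, ∀ m ≥ N, ∀ n ≥ N, |q.form (u m - u n) (u m - u n)| < ε

/-- The form is symmetric and non-negative. -/
def IsSymmNonneg (q : PartialForm H) : Prop :=
  (∀ u v, q.form u v = q.form v u) ∧ ∀ u, 0 ≤ q.form u u

/-- Closability: if `u n → 0` in `H` and `u` is `q`-Cauchy, then `q (u n, u n) → 0`. -/
def IsClosable (q : PartialForm H) : Prop :=
  ∀ u : ℕ → q.domain, q.Approximates u 0 → Tendsto (fun n => q.form (u n) (u n)) atTop (𝓝 0)

/-- Closedness: if `u n → x` in `H` and `u` is `q`-Cauchy, then `x` is in the domain and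
`q (u n - x, u n - x) → 0`. -/
def IsClosed (q : PartialForm H) : Prop :=
  ∀ (u : ℕ → q.domain) (x : H), q.Approximates u x →
    ∃ hx : x ∈ q.domain, Tendsto (fun n => q.form (u n - ⟨x, hx⟩) (u n - ⟨x, hx⟩)) atTop (𝓝 0)

/-- `r` is the closure of `q`: its domain consists of the limits of `q`-Cauchy sequences that
converge in `H`, and `r (x, y) = lim q (u n, v n)` for any such sequences `u n → x`, `v n → y`. -/
def IsClosureOf (r q : PartialForm H) : Prop :=
  (∀ x, x ∈ r.domain ↔ ∃ u, q.Approximates u x) ∧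
    ∀ (x y : r.domain) (u v : ℕ → q.domain), q.Approximates u x → q.Approximates v y →
      Tendsto (fun n => q.form (u n) (v n)) atTop (𝓝 (r.form x y))

/-- The operator `B` is the generator of the form `q`: its domain is the set of `u ∈ D(q)` for which
some `w ∈ H` satisfies `q (u, v) = ⟨-w, v⟩` for all `v ∈ D(q)`, and `B u = w`. -/
def IsGenerator (q : PartialForm H) (B : H →ₗ.[ℝ] H) : Prop :=
  ∀ u w : H, (u, w) ∈ B.graph ↔
    ∃ hu : u ∈ q.domain, ∀ v : q.domain, q.form ⟨u, hu⟩ v = ⟪-w, (v : H)⟫_ℝ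

end PartialForm

/-- The form `(u, v) ↦ ⟨A u, v⟩` on the domain of the operator `A`. -/
def operatorForm (A : H →ₗ.[ℝ] H) : PartialForm H where
  domain := A.domain
  form := ((innerₗ H).comp A.toFun).compl₂ A.domain.subtype

/-- `B` is the Friedrichs extension of the densely defined non-negative symmetric operator `A`: the
self-adjoint extension whose domain is contained in the form domain of `A`, i.e. in the domain of
the closure of `(u, v) ↦ ⟨A u, v⟩`. -/
structure IsFriedrichsExtension [CompleteSpace H] (A B : H →ₗ.[ℝ] H) : Prop where
  dense : Dense (A.domain : Set H)
  symmetric : A.IsFormalAdjoint A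
  nonneg : ∀ u : A.domain, 0 ≤ ⟪A u, (u : H)⟫_ℝ
  le : A ≤ B
  selfAdjoint : IsSelfAdjoint B
  domain_le : ∀ x ∈ B.domain, ∃ u, (operatorForm A).Approximates u x

end Forms

end ConeCalculus

end

/-!
The whole statement rests on one integration by parts. For the Poisson measure with intensity `m`
the Mecke identity says that
`∫ ∑_{y ∈ γ} Φ(γ, y) dπ(γ) = ∫ ∫ Φ(γ + δ_y, y) dm(y) dπ(γ)`.
Applied to `Φ = s (F(γ - δ_y) - F(γ)) G(γ - δ_y)` with `y = (s, x)`, it turns the part of the energy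
that contains `G(η - s_x δ_x)` into the birth part of the operator, so that `ℰ(F, G) = ⟨-LF, G⟩`
(`IsPoissonMeasure.integral_energyIncr`, `dirichletForm_eq`). As `ℰ` is symmetric and non-negative,
so is `-L`. The rest is Friedrichs' theorem, once `𝓕` is known to be dense and `L` to respect
`μ`-classes.

*The Mecke identity.* A Poisson measure is given only through its Laplace transform. Its derivative
in a direction `f` yields the identity for `Φ(γ, y) = f(y) exp (-⟨γ, h⟩)`
(`IsPoissonMeasure.lintegral_exp`). A finite measure on an orthant is determined by its Laplace
transform (`measure_ext_of_laplace`), hence the joint laws of `(⟨γ, φ₁⟩, …, ⟨γ, φ_N⟩, y)` under the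
Campbell measure and under the law with an added point agree (`IsPoissonMeasure.campbellLaw_eq`). No
other `Φ` is needed, because cylinder functions depend on `γ` only through such a vector. The
identity also gives the first two moments of `π`, hence square integrability of `LF`, finiteness of
the local masses, and, as `σ` is non-atomic, the absence of two points over the same `x`. So `π`
lives on `Π(X̂)`, and `μ`, its image under `ℛ`, is a probability measure for which the atoms of `η`
form a Poisson configuration (`IsPoissonMeasure.measurePreserving_atoms`).

*Measurability.* The Borel `σ`-algebras of the vague topologies are generated by the pairings with
`f ∈ C_c`, by separability of `C_c` (`measurable_of_measurable_integral`). The map `η ↦ ℛ⁻¹η` is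
measurable because `(η, x) ↦ η({x})` is (`measurable_atoms`).

*Density.* If `u` is orthogonal to `𝓕`, the finite measures with densities `u⁺` and `u⁻` have the
same integrals of cylinder functions. These integrals determine the joint laws of the functionals
`⟨ℛ⁻¹η, φ⟩`, which generate the `σ`-algebra of the cone, so `u⁺ = u⁻` almost everywhere
(`ae_eq_zero_of_integral_cylinder`). If `F ∈ 𝓕` vanishes almost everywhere, then
`⟨LF, G⟩ = ⟨F, LG⟩ = 0` for all `G ∈ 𝓕`, and density gives `LF = 0`: the operator is well defined on
classes.

*Friedrichs' theorem.* A symmetric non-negative operator `A` factors on its domain as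
`⟨A u, v⟩ = ⟨T u, T v⟩`, with `T` the map into the completion for the form. Symmetry makes `T`
closable, and with `S` its closure the form `⟨S u, S v⟩` is the closure of the form of `A`, while
`S*S`, self-adjoint by von Neumann's theorem (`isSelfAdjoint_adjointComp`), is the Friedrichs
extension (`exists_isFriedrichsExtension`).
-/

open MeasureTheory Filter Topology Set
open scoped ENNReal CompactlySupported BoundedContinuousFunction InnerProductSpace

noncomputable section

namespace ConeCalculus

/-! ### Friedrichs extensions of non-negative symmetric operators -/

section Friedrichs

universe u

variable {H : Type*} [NormedAddCommGroup H] [InnerProductSpace ℝ H]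

/-- A non-negative symmetric bilinear form is the inner product of a Hilbert space in which the
vector space maps densely: the completion for the seminorm of the form. -/
theorem exists_hilbert_of_bilinForm {V : Type u} [AddCommGroup V] [Module ℝ V]
    (q : V →ₗ[ℝ] V →ₗ[ℝ] ℝ) (hs : ∀ u v, q u v = q v u) (hn : ∀ u, 0 ≤ q u u) :
    ∃ (K : Type u) (_ : NormedAddCommGroup K) (_ : InnerProductSpace ℝ K) (_ : CompleteSpace K)
      (T : V →ₗ[ℝ] K), (∀ u v, ⟪T u, T v⟫_ℝ = q u v) ∧ DenseRange T := by
  let core : PreInnerProductSpace.Core ℝ V :=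
    { inner := fun u v => q u v
      conj_inner_symm := fun u v => by simp [hs v u]
      re_inner_nonneg := fun u => by simpa using hn u
      add_left := fun u v w => by simp
      smul_left := fun u v r => by simp }
  let _ : SeminormedAddCommGroup V := InnerProductSpace.Core.toSeminormedAddCommGroup (c := core)
  let _ : InnerProductSpace ℝ V := InnerProductSpace.ofCore core
  refine ⟨UniformSpace.Completion V, inferInstance, inferInstance, inferInstance,
    (UniformSpace.Completion.toComplL : V →L[ℝ] UniformSpace.Completion V).toLinearMap,
    fun u v => ?_, UniformSpace.Completion.denseRange_coe⟩
  exact UniformSpace.Completion.inner_coe u v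

/-- A symmetric operator `B` such that `1 + B` is onto is self-adjoint. -/
theorem isSelfAdjoint_of_surjective [CompleteSpace H] {B : H →ₗ.[ℝ] H} (hs : B.IsFormalAdjoint B)
    (hB : ∀ w : H, ∃ z : B.domain, (z : H) + B z = w) : IsSelfAdjoint B := by
  have hsym : ∀ u v : B.domain, ⟪(u : H) + B u, (v : H)⟫_ℝ = ⟪(u : H), (v : H) + B v⟫_ℝ := by
    intro u v
    rw [inner_add_left, inner_add_right, hs u v]
  have hd : Dense (B.domain : Set H) := by
    rw [Submodule.dense_iff_topologicalClosure_eq_top, Submodule.topologicalClosure_eq_top_iff,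
      Submodule.eq_bot_iff]
    intro x hx
    obtain ⟨z, rfl⟩ := hB x
    obtain ⟨v, hv⟩ := hB (z : H)
    have h1 : ⟪(v : H), (z : H) + B z⟫_ℝ = 0 := (Submodule.mem_orthogonal _ _).1 hx v v.2
    rw [← hsym, hv, inner_self_eq_zero] at h1
    have : z = 0 := Subtype.ext h1
    simp [this]
  rw [LinearPMap.isSelfAdjoint_def]
  refine (le_antisymm ?_ (hs.le_adjoint hd) :)
  refine LinearPMap.le_of_le_graph fun p hp => ?_
  obtain ⟨u, hu', hu⟩ := (LinearPMap.mem_graph_iff _).1 hp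
  obtain ⟨z, hz⟩ := hB (u + B.adjoint u)
  -- `u - z` is orthogonal to the range of `1 + B`
  have key : (u : H) - z = 0 := by
    obtain ⟨v, hv⟩ := hB ((u : H) - z)
    have h1 : ⟪(u : H) - z, (v : H) + B v⟫_ℝ = 0 := by
      rw [inner_sub_left, ← hsym, hz, inner_add_left, inner_add_right,
        LinearPMap.adjoint_isFormalAdjoint hd u v, sub_self]
    rwa [hv, inner_self_eq_zero] at h1
  have hzu : (z : H) = u := (sub_eq_zero.1 key).symm
  refine (LinearPMap.mem_graph_iff _).2 ⟨z, hzu.trans hu', ?_⟩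
  rw [hzu] at hz
  rw [← hu]
  exact add_left_cancel hz

variable {K : Type*} [NormedAddCommGroup K] [InnerProductSpace ℝ K]

/-- The graph of `S*S`: the pairs `(u, w)` with `⟪S u, S v⟫ = ⟪w, v⟫` for all `v ∈ D(S)`. -/
def adjointCompGraph (S : H →ₗ.[ℝ] K) : Submodule ℝ (H × H) where
  carrier := {p | ∃ hu : p.1 ∈ S.domain, ∀ v : S.domain, ⟪S ⟨p.1, hu⟩, S v⟫_ℝ = ⟪p.2, (v : H)⟫_ℝ}
  add_mem' := by
    rintro ⟨a, b⟩ ⟨c, d⟩ ⟨ha, hb⟩ ⟨hc, hd⟩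
    refine ⟨S.domain.add_mem ha hc, fun v => ?_⟩
    have : (⟨a + c, S.domain.add_mem ha hc⟩ : S.domain) = ⟨a, ha⟩ + ⟨c, hc⟩ := rfl
    simp only [Prod.mk_add_mk, this]
    rw [LinearPMap.map_add, inner_add_left, hb v, hd v, ← inner_add_left]
  zero_mem' := ⟨S.domain.zero_mem, fun v => by
    have : (⟨0, S.domain.zero_mem⟩ : S.domain) = 0 := rfl
    simp [this]⟩
  smul_mem' := by
    rintro r ⟨a, b⟩ ⟨ha, hb⟩
    refine ⟨S.domain.smul_mem r ha, fun v => ?_⟩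
    have : (⟨r • a, S.domain.smul_mem r ha⟩ : S.domain) = r • ⟨a, ha⟩ := rfl
    simp only [Prod.smul_mk, this]
    rw [LinearPMap.map_smul, real_inner_smul_left, real_inner_smul_left, hb v]

theorem mem_adjointCompGraph {S : H →ₗ.[ℝ] K} {u w : H} : (u, w) ∈ adjointCompGraph S ↔
    ∃ hu : u ∈ S.domain, ∀ v : S.domain, ⟪S ⟨u, hu⟩, S v⟫_ℝ = ⟪w, (v : H)⟫_ℝ := Iff.rfl

/-- The operator `S*S`. -/
def adjointComp (S : H →ₗ.[ℝ] K) : H →ₗ.[ℝ] H := (adjointCompGraph S).toLinearPMap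

theorem graph_adjointComp {S : H →ₗ.[ℝ] K} (hS : Dense (S.domain : Set H)) :
    (adjointComp S).graph = adjointCompGraph S := by
  refine Submodule.toLinearPMap_graph_eq _ ?_
  rintro ⟨u, w⟩ ⟨hu, h⟩ (rfl : u = 0)
  refine hS.eq_zero_of_inner_left ℝ fun v hv => ?_
  have := h ⟨v, hv⟩
  have h0 : (⟨0, hu⟩ : S.domain) = 0 := rfl
  simpa [h0] using this.symm

/-- von Neumann's theorem: `S*S` is self-adjoint for a closed densely defined operator `S` between
Hilbert spaces. -/
theorem isSelfAdjoint_adjointComp [CompleteSpace H] [CompleteSpace K] {S : H →ₗ.[ℝ] K}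
    (hS : Dense (S.domain : Set H)) (hc : S.IsClosed) : IsSelfAdjoint (adjointComp S) := by
  have hmem : ∀ u : (adjointComp S).domain, ((u : H), adjointComp S u) ∈ adjointCompGraph S :=
    fun u => graph_adjointComp hS ▸ LinearPMap.mem_graph _ u
  refine isSelfAdjoint_of_surjective (fun u v => ?_) fun w => ?_
  · obtain ⟨hu, h1⟩ := hmem u
    obtain ⟨hv, h2⟩ := hmem v
    have h1 := h1 ⟨v, hv⟩
    have h2 := h2 ⟨u, hu⟩
    rw [real_inner_comm] at h2
    simp only at h1 h2
    rw [← h1, h2, real_inner_comm]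
  · -- `(w, 0) = (u, S u) + (w - u, -S u)` is the orthogonal decomposition along the graph of `S`
    let e : WithLp 2 (H × K) ≃L[ℝ] H × K := WithLp.prodContinuousLinearEquiv 2 ℝ H K
    let G : Submodule ℝ (WithLp 2 (H × K)) := S.graph.comap (e : WithLp 2 (H × K) →ₗ[ℝ] H × K)
    have hGc : IsClosed (G : Set (WithLp 2 (H × K))) := hc.preimage e.continuous
    have : CompleteSpace G := hGc.completeSpace_coe
    have hex : ∃ y ∈ G, ∀ g ∈ G, ⟪WithLp.toLp 2 (w, 0) - y, g⟫_ℝ = 0 := by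
      refine ⟨G.starProjection (WithLp.toLp 2 (w, (0 : K))), Submodule.starProjection_apply_mem _ _,
        fun g hg => ?_⟩
      have := Submodule.sub_starProjection_mem_orthogonal (K := G) (WithLp.toLp 2 (w, (0 : K)))
      rw [real_inner_comm]
      exact (Submodule.mem_orthogonal _ _).1 this g hg
    obtain ⟨y, hy, hort⟩ := hex
    obtain ⟨u, hu1, hu2⟩ := (LinearPMap.mem_graph_iff _).1 (show e y ∈ S.graph from hy)
    have hgr : ((u : H), w - u) ∈ (adjointComp S).graph := by
      rw [graph_adjointComp hS]
      refine ⟨u.2, fun v => ?_⟩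
      have h := hort (WithLp.toLp 2 ((v : H), S v)) (LinearPMap.mem_graph _ v)
      have hy' : y = WithLp.toLp 2 ((u : H), S u) := by
        apply e.injective
        exact Prod.ext hu1.symm hu2.symm
      rw [hy', ← WithLp.toLp_sub, WithLp.prod_inner_apply] at h
      simp only [Prod.mk_sub_mk, zero_sub, inner_neg_left] at h
      change ⟪S u, S v⟫_ℝ = _
      linarith
    obtain ⟨z, hz1, hz2⟩ := (LinearPMap.mem_graph_iff _).1 hgr
    refine ⟨z, ?_⟩
    simp only at hz1 hz2
    rw [hz1, hz2]
    abel

/-- The form `(x, y) ↦ ⟪S x, S y⟫` on the domain of the operator `S`. -/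
def energyForm (S : H →ₗ.[ℝ] K) : PartialForm H where
  domain := S.domain
  form := ((innerₗ K).comp S.toFun).compl₂ S.toFun

/-- A sequence is Cauchy for the form of `S` exactly when its image under `S` is Cauchy. -/
theorem approximates_iff_of_form {q : PartialForm H} {T : q.domain →ₗ[ℝ] K}
    (hT : ∀ u v, ⟪T u, T v⟫_ℝ = q.form u v) {u : ℕ → q.domain} {x : H} :
    q.Approximates u x ↔
      Tendsto (fun n => (u n : H)) atTop (𝓝 x) ∧ CauchySeq fun n => T (u n) := by
  refine and_congr_right fun _ => ?_
  have hq : ∀ m n, |q.form (u m - u n) (u m - u n)| = ‖T (u m) - T (u n)‖ ^ 2 := by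
    intro m n
    rw [← hT, real_inner_self_eq_norm_sq, abs_of_nonneg (sq_nonneg _), map_sub]
  simp_rw [Metric.cauchySeq_iff, hq, dist_eq_norm]
  constructor
  · intro h ε hε
    obtain ⟨N, hN⟩ := h (ε ^ 2) (by positivity)
    exact ⟨N, fun m hm n hn => lt_of_pow_lt_pow_left₀ 2 hε.le (hN m hm n hn)⟩
  · intro h ε hε
    obtain ⟨N, hN⟩ := h (√ε) (Real.sqrt_pos.2 hε)
    refine ⟨N, fun m hm n hn => ?_⟩
    have := pow_lt_pow_left₀ (hN m hm n hn) (norm_nonneg _) two_ne_zero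
    rwa [Real.sq_sqrt hε.le] at this

/-- The form of a closed operator is closed. -/
theorem isClosed_energyForm [CompleteSpace K] {S : H →ₗ.[ℝ] K} (hc : S.IsClosed) :
    (energyForm S).IsClosed := by
  intro u x hu
  rw [approximates_iff_of_form (T := S.toFun) (fun _ _ => rfl)] at hu
  obtain ⟨h1, h2⟩ := hu
  obtain ⟨k, hk⟩ := cauchySeq_tendsto_of_complete h2
  have hmem : (x, k) ∈ S.graph :=
    hc.mem_of_tendsto (h1.prodMk_nhds hk) (Eventually.of_forall fun n => LinearPMap.mem_graph _ _)
  obtain ⟨y, rfl, rfl⟩ := (LinearPMap.mem_graph_iff _).1 hmem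
  refine ⟨y.2, ?_⟩
  have h3 : Tendsto (fun n => S.toFun (u n - show (energyForm S).domain from y)) atTop (𝓝 0) := by
    refine Tendsto.congr (fun n => (map_sub S.toFun _ _).symm) ?_
    exact tendsto_sub_nhds_zero_iff.2 hk
  have h4 := h3.inner (𝕜 := ℝ) h3
  rwa [inner_zero_left] at h4

theorem isSymmNonneg_energyForm (S : H →ₗ.[ℝ] K) : (energyForm S).IsSymmNonneg :=
  ⟨fun _ _ => real_inner_comm _ _, fun _ => real_inner_self_nonneg⟩

/-- A factor `T` of the form of `A` with dense range is closable: if `x_n → 0` and `T x_n → k`, then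
`⟪k, T v⟫ = lim ⟪x_n, A v⟫ = 0` for all `v`. -/
theorem isClosable_of_form {A : H →ₗ.[ℝ] H} {T : A.domain →ₗ[ℝ] K}
    (hT : ∀ u v, ⟪T u, T v⟫_ℝ = ⟪(u : H), A v⟫_ℝ) (hr : DenseRange T) :
    (LinearPMap.mk A.domain T).IsClosable := by
  refine ⟨_, (Submodule.toLinearPMap_graph_eq _ ?_).symm⟩
  rintro ⟨x, k⟩ hk (rfl : x = 0)
  obtain ⟨p, hp, hlim⟩ := mem_closure_iff_seq_limit.1
    (show ((0 : H), k) ∈ closure ((LinearPMap.mk A.domain T).graph : Set (H × K)) from hk)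
  have hr' : Dense (LinearMap.range T : Set K) := by rwa [LinearMap.coe_range]
  refine hr'.eq_zero_of_inner_left ℝ fun v hv => ?_
  obtain ⟨v, rfl⟩ := hv
  have h1 : Tendsto (fun n => ⟪(p n).2, T v⟫_ℝ) atTop (𝓝 ⟪k, T v⟫_ℝ) :=
    (((continuous_snd.tendsto _).comp hlim).inner (𝕜 := ℝ) tendsto_const_nhds :)
  have h2 : Tendsto (fun n => ⟪(p n).1, A v⟫_ℝ) atTop (𝓝 ⟪(0 : H), A v⟫_ℝ) :=
    (((continuous_fst.tendsto _).comp hlim).inner (𝕜 := ℝ) tendsto_const_nhds :)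
  have h3 : ∀ n, ⟪(p n).2, T v⟫_ℝ = ⟪(p n).1, A v⟫_ℝ := by
    intro n
    obtain ⟨y, hy1, hy2⟩ := (LinearPMap.mem_graph_iff _).1 (hp n)
    rw [← hy1, ← hy2]
    exact hT y v
  simp_rw [h3] at h1
  rw [tendsto_nhds_unique h1 h2, inner_zero_left]

/-- Friedrichs' theorem: the form of a densely defined, symmetric, non-negative operator `A` is
closable, and the self-adjoint operator associated with its closure is a Friedrichs extension
of `A`. -/
theorem exists_isFriedrichsExtension [CompleteSpace H] {A : H →ₗ.[ℝ] H}
    (hd : Dense (A.domain : Set H)) (hs : A.IsFormalAdjoint A)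
    (hn : ∀ u : A.domain, 0 ≤ ⟪A u, (u : H)⟫_ℝ) :
    (operatorForm A).IsSymmNonneg ∧ (operatorForm A).IsClosable ∧
      ∃ (B : H →ₗ.[ℝ] H) (r : PartialForm H), IsFriedrichsExtension A B ∧
        r.IsClosureOf (operatorForm A) ∧ r.IsClosed ∧ r.IsSymmNonneg ∧ r.IsGenerator (-B) := by
  have hsym : ∀ u v, (operatorForm A).form u v = (operatorForm A).form v u := fun u v => by
    change ⟪A u, (v : H)⟫_ℝ = ⟪A v, (u : H)⟫_ℝ
    rw [hs u v, real_inner_comm]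
  have hsn : (operatorForm A).IsSymmNonneg := ⟨hsym, hn⟩
  obtain ⟨K, _, _, _, T, hT, hr⟩ := exists_hilbert_of_bilinForm _ hsn.1 hsn.2
  have hcl : (LinearPMap.mk A.domain T).IsClosable :=
    isClosable_of_form (fun u v => (hT u v).trans (hs u v)) hr
  set S := (LinearPMap.mk A.domain T).closure with hS
  have hle : LinearPMap.mk A.domain T ≤ S := LinearPMap.le_closure _
  have hSc : S.IsClosed := hcl.closure_isClosed
  have hSd : Dense (S.domain : Set H) := hd.mono hle.1
  -- `x ∈ D(S)` and `S x = k` exactly when some sequence in `D(A)` tends to `x` with images to `k`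
  have hgraph : ∀ x k, (x, k) ∈ S.graph ↔ ∃ u : ℕ → A.domain,
      Tendsto (fun n => (u n : H)) atTop (𝓝 x) ∧ Tendsto (fun n => T (u n)) atTop (𝓝 k) := by
    intro x k
    rw [hS, ← hcl.graph_closure_eq_closure_graph]
    change (x, k) ∈ closure ((LinearPMap.mk A.domain T).graph : Set (H × K)) ↔ _
    rw [mem_closure_iff_seq_limit]
    constructor
    · rintro ⟨p, hp, hlim⟩
      choose y hy1 hy2 using fun n => (LinearPMap.mem_graph_iff _).1 (hp n)
      refine ⟨y, ?_, ?_⟩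
      · simp_rw [hy1]; exact (continuous_fst.tendsto _).comp hlim
      · have : (fun n => T (y n)) = fun n => (p n).2 := funext hy2
        rw [this]; exact (continuous_snd.tendsto _).comp hlim
    · rintro ⟨u, h1, h2⟩
      exact ⟨fun n => ((u n : H), T (u n)), fun n =>
        LinearPMap.mem_graph (LinearPMap.mk A.domain T) (u n), h1.prodMk_nhds h2⟩
  have happ : ∀ x, x ∈ S.domain ↔ ∃ u, (operatorForm A).Approximates u x := by
    intro x
    simp_rw [approximates_iff_of_form hT]
    constructor
    · intro hx
      obtain ⟨u, h1, h2⟩ := (hgraph x (S ⟨x, hx⟩)).1 (LinearPMap.mem_graph S ⟨x, hx⟩)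
      exact ⟨u, h1, h2.cauchySeq⟩
    · rintro ⟨u, h1, h2⟩
      obtain ⟨k, hk⟩ := cauchySeq_tendsto_of_complete h2
      obtain ⟨y, hy, -⟩ := (LinearPMap.mem_graph_iff _).1 ((hgraph x k).2 ⟨u, h1, hk⟩)
      have hy : (y : H) = x := hy
      exact hy ▸ y.2
  have hlim : ∀ (x : S.domain) u, (operatorForm A).Approximates u (x : H) →
      Tendsto (fun n => T (u n)) atTop (𝓝 (S x)) := by
    intro x u hu
    rw [approximates_iff_of_form hT] at hu
    obtain ⟨k, hk⟩ := cauchySeq_tendsto_of_complete hu.2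
    obtain ⟨y, hy, hy'⟩ := (LinearPMap.mem_graph_iff _).1 ((hgraph x k).2 ⟨u, hu.1, hk⟩)
    have : y = x := Subtype.ext hy
    rw [← this, hy']
    exact hk
  have hclos : (energyForm S).IsClosureOf (operatorForm A) := by
    refine ⟨happ, fun x y u v hu hv => ?_⟩
    have := (hlim x u hu).inner (𝕜 := ℝ) (hlim y v hv)
    simp_rw [hT] at this
    exact this
  have hB : (adjointComp S).graph = adjointCompGraph S := graph_adjointComp hSd
  refine ⟨hsn, fun u hu => ?_, adjointComp S, energyForm S,
    ⟨hd, hs, hn, ?_, isSelfAdjoint_adjointComp hSd hSc, fun x hx => ?_⟩, hclos,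
    isClosed_energyForm hSc, isSymmNonneg_energyForm S, fun u w => ?_⟩
  · have := hclos.2 0 0 u u hu hu
    rwa [map_zero] at this
  · refine LinearPMap.le_of_le_graph ?_
    rw [hB]
    rintro ⟨u, w⟩ huw
    obtain ⟨u, rfl, rfl⟩ := (LinearPMap.mem_graph_iff _).1 huw
    have hu : (u : H) ∈ S.domain := hle.1 u.2
    refine ⟨hu, fun v => ?_⟩
    obtain ⟨vn, hv⟩ := (happ v).1 v.2
    have h1 : Tendsto (fun n => ⟪T u, T (vn n)⟫_ℝ) atTop (𝓝 ⟪S ⟨u, hu⟩, S v⟫_ℝ) := by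
      have h := hle.2 (x := u) (y := ⟨u, hu⟩) rfl
      rw [← h]
      exact tendsto_const_nhds.inner (hlim v vn hv)
    have h2 : Tendsto (fun n => ⟪A u, (vn n : H)⟫_ℝ) atTop (𝓝 ⟪A u, (v : H)⟫_ℝ) :=
      tendsto_const_nhds.inner hv.1
    exact tendsto_nhds_unique (h1.congr fun n => hT u (vn n)) h2
  · have h := LinearPMap.mem_graph (adjointComp S) ⟨x, hx⟩
    rw [hB] at h
    exact (happ x).1 h.1
  · have : (u, w) ∈ (-adjointComp S).graph ↔ (u, -w) ∈ (adjointComp S).graph := by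
      simp only [LinearPMap.mem_graph_iff]
      constructor
      · rintro ⟨y, hy, hy'⟩
        refine ⟨y, hy, ?_⟩
        rw [← hy', LinearPMap.neg_apply, neg_neg]
      · rintro ⟨y, hy, hy'⟩
        refine ⟨y, hy, ?_⟩
        rw [LinearPMap.neg_apply, hy', neg_neg]
    rw [this, hB]
    exact mem_adjointCompGraph

end Friedrichs

/-! ### Compactly supported functions, Radon measures and the vague topology -/

section Vague

variable {Z : Type*} [TopologicalSpace Z] [T2Space Z] [LocallyCompactSpace Z]

/-- A compact set has a compactly supported continuous cutoff `0 ≤ f ≤ 1` supported in a given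
neighbourhood. -/
theorem exists_cutoff {K U : Set Z} (hK : IsCompact K) (hU : IsOpen U) (hKU : K ⊆ U) :
    ∃ f : C_c(Z, ℝ), (∀ x, 0 ≤ f x) ∧ (∀ x, f x ≤ 1) ∧ (∀ x ∉ U, f x = 0) ∧ ∀ x ∈ K, f x = 1 := by
  obtain ⟨f, h1, h2, h3, h4⟩ := exists_continuousMap_one_of_isCompact_subset_isOpen hK hU hKU
  exact ⟨⟨f, h2⟩, fun x => (h4 x).1, fun x => (h4 x).2,
    fun x hx => image_eq_zero_of_notMem_tsupport fun h => hx (h3 h), fun x hx => h1 hx⟩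

variable [SecondCountableTopology Z]

/-- The indicator of an open set is the pointwise limit of cutoffs supported in it. -/
theorem exists_seq_cutoff {U : Set Z} (hU : IsOpen U) :
    ∃ f : ℕ → C_c(Z, ℝ), (∀ n x, 0 ≤ f n x) ∧ (∀ n x, f n x ≤ 1) ∧ (∀ n, ∀ x ∉ U, f n x = 0) ∧
      ∀ x ∈ U, ∀ᶠ n in atTop, f n x = 1 := by
  have : LocallyCompactSpace U := hU.locallyCompactSpace
  let E : CompactExhaustion U := CompactExhaustion.choice U
  have hc : ∀ n, IsCompact (Subtype.val '' E n) := fun n =>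
    (E.isCompact n).image continuous_subtype_val
  choose f h0 h1 hs h using fun n => exists_cutoff (hc n) hU (by rintro _ ⟨x, -, rfl⟩; exact x.2)
  refine ⟨f, h0, h1, hs, fun x hx => ?_⟩
  obtain ⟨n, hn⟩ := E.exists_mem ⟨x, hx⟩
  filter_upwards [eventually_ge_atTop n] with m hm
  exact h m x ⟨⟨x, hx⟩, E.subset hm hn, rfl⟩

variable [MeasurableSpace Z] [BorelSpace Z]

omit [T2Space Z] [LocallyCompactSpace Z] [SecondCountableTopology Z] in
theorem measurable_ofReal_coe (f : C_c(Z, ℝ)) : Measurable fun x => ENNReal.ofReal (f x) :=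
  ENNReal.measurable_ofReal.comp f.continuous.measurable

/-- A sequence of functions that are bounded by the indicator of a set and eventually equal to it
pointwise computes the measure of the set as the lower limit of the integrals. -/
theorem measure_eq_liminf_lintegral {α : Type*} [MeasurableSpace α] {s : Set α}
    (hs : MeasurableSet s) {f : ℕ → α → ℝ≥0∞} (hf : ∀ n, Measurable (f n)) (h1 : ∀ n x, f n x ≤ 1)
    (h0 : ∀ n, ∀ x ∉ s, f n x = 0) (h : ∀ x ∈ s, ∀ᶠ n in atTop, f n x = 1) (μ : Measure α) :
    μ s = liminf (fun n => ∫⁻ x, f n x ∂μ) atTop := by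
  have hle : ∀ n x, f n x ≤ s.indicator 1 x := by
    intro n x
    by_cases hx : x ∈ s
    · simpa [hx] using h1 n x
    · simp [hx, h0 n x hx]
  refine le_antisymm ?_ ?_
  · calc μ s = ∫⁻ x, liminf (fun n => f n x) atTop ∂μ := by
          rw [← lintegral_indicator_one hs]
          refine lintegral_congr fun x => ?_
          by_cases hx : x ∈ s
          · rw [Filter.liminf_congr (h x hx)]; simp [hx]
          · have : (fun n => f n x) = fun _ => 0 := funext fun n => h0 n x hx
            simp [this, hx]
      _ ≤ _ := lintegral_liminf_le hf
  · have : ∀ n, ∫⁻ x, f n x ∂μ ≤ μ s := fun n => by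
      rw [← lintegral_indicator_one hs]
      exact lintegral_mono (hle n)
    calc liminf (fun n => ∫⁻ x, f n x ∂μ) atTop ≤ liminf (fun _ : ℕ => μ s) atTop :=
          liminf_le_liminf (Eventually.of_forall this)
      _ = μ s := by simp

/-- A family of measures that are finite on compact sets depends measurably on its parameter if
the integrals of all non-negative `f ∈ C_c` do. -/
theorem measurable_measure_of_lintegral {W : Type*} [MeasurableSpace W] {M : W → Measure Z}
    [hM : ∀ w, IsFiniteMeasureOnCompacts (M w)]
    (h : ∀ f : C_c(Z, ℝ), (∀ x, 0 ≤ f x) → Measurable fun w => ∫⁻ x, ENNReal.ofReal (f x) ∂M w) :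
    Measurable M := by
  have hopen : ∀ U, IsOpen U → Measurable fun w => M w U := by
    intro U hU
    obtain ⟨f, h0, h1, hs, hf⟩ := exists_seq_cutoff hU
    have : (fun w => M w U) = fun w => liminf (fun n => ∫⁻ x, ENNReal.ofReal (f n x) ∂M w) atTop :=
      funext fun w => measure_eq_liminf_lintegral hU.measurableSet
        (fun n => measurable_ofReal_coe (f n))
        (fun n x => ENNReal.ofReal_le_one.2 (h1 n x)) (fun n x hx => by simp [hs n x hx])
        (fun x hx => (hf x hx).mono fun n hn => by simp [hn]) _
    rw [this]
    exact .liminf fun n => h _ (h0 n)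
  let E : CompactExhaustion Z := CompactExhaustion.choice Z
  have hE : ⋃ n, interior (E n) = univ := eq_univ_of_forall fun x => by
    obtain ⟨n, hn⟩ := E.exists_mem x
    exact mem_iUnion.2 ⟨n + 1, E.subset_interior_succ n hn⟩
  have hEm : Monotone fun n => interior (E n) := fun m n hmn => interior_mono (E.subset hmn)
  have hres : ∀ n, Measurable fun w => (M w).restrict (interior (E n)) := by
    intro n
    have : ∀ w, IsFiniteMeasure ((M w).restrict (interior (E n))) := fun w =>
      ⟨by rw [Measure.restrict_apply_univ]
          exact (measure_mono interior_subset).trans_lt (E.isCompact n).measure_lt_top⟩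
    refine Measurable.measure_of_isPiSystem (S := {s | IsOpen s})
      BorelSpace.measurable_eq isPiSystem_isOpen (fun U hU => ?_) ?_
    · simp_rw [Measure.restrict_apply (IsOpen.measurableSet hU)]
      exact hopen _ (IsOpen.inter hU isOpen_interior)
    · simp_rw [Measure.restrict_apply_univ]
      exact hopen _ isOpen_interior
  refine Measure.measurable_of_measurable_coe _ fun B hB => ?_
  have : (fun w => M w B) = fun w => ⨆ n, (M w).restrict (interior (E n)) B := by
    funext w
    simp_rw [Measure.restrict_apply hB]
    rw [← Monotone.measure_iUnion, ← inter_iUnion, hE, inter_univ]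
    exact fun m n hmn => inter_subset_inter_right _ (hEm hmn)
  rw [this]
  exact .iSup fun n => (Measure.measurable_coe hB).comp (hres n)

/-- A kernel all of whose measures are finite is s-finite: split the parameter space according to
the integer part of the total mass. -/
theorem isSFiniteKernel_of_isFiniteMeasure {W Z : Type*} [MeasurableSpace W] [MeasurableSpace Z]
    (κ : ProbabilityTheory.Kernel W Z) [∀ w, IsFiniteMeasure (κ w)] :
    ProbabilityTheory.IsSFiniteKernel κ := by
  classical
  have hm : ∀ n : ℕ, MeasurableSet {w | ⌊(κ w univ).toReal⌋₊ = n} := fun n =>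
    (Nat.measurable_floor.comp (κ.measurable_coe MeasurableSet.univ).ennreal_toReal)
      (measurableSet_singleton n)
  have hfin : ∀ n : ℕ, ProbabilityTheory.IsFiniteKernel
      (ProbabilityTheory.Kernel.piecewise (hm n) κ 0) := by
    intro n
    refine ⟨⟨n + 1, by finiteness, fun w => ?_⟩⟩
    rw [ProbabilityTheory.Kernel.piecewise_apply]
    split_ifs with h
    · have h1 : (κ w univ).toReal < n + 1 := by
        have := Nat.lt_floor_add_one (κ w univ).toReal
        rwa [show ⌊(κ w univ).toReal⌋₊ = n from h] at this
      rw [← ENNReal.ofReal_toReal (measure_ne_top (κ w) univ)]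
      exact (ENNReal.ofReal_le_ofReal h1.le).trans (by simp [ENNReal.ofReal_add])
    · simp
  have hsum : κ = ProbabilityTheory.Kernel.sum
      fun n : ℕ => ProbabilityTheory.Kernel.piecewise (hm n) κ 0 := by
    refine ProbabilityTheory.Kernel.ext fun w => Measure.ext fun s hs => ?_
    rw [ProbabilityTheory.Kernel.sum_apply' _ _ hs, tsum_eq_single ⌊(κ w univ).toReal⌋₊]
    · rw [ProbabilityTheory.Kernel.piecewise_apply, if_pos]
      rfl
    · intro n hn
      rw [ProbabilityTheory.Kernel.piecewise_apply, if_neg fun h => hn h.symm]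
      simp
  rw [hsum]
  infer_instance

/-- A kernel of measures that are finite on compact sets is s-finite. -/
theorem isSFiniteKernel_of_isFiniteMeasureOnCompacts {W : Type*} [MeasurableSpace W]
    (κ : ProbabilityTheory.Kernel W Z) [∀ w, IsFiniteMeasureOnCompacts (κ w)] :
    ProbabilityTheory.IsSFiniteKernel κ := by
  have hm : ∀ n, MeasurableSet (disjointed (compactCovering Z) n) := fun n =>
    MeasurableSet.disjointed (fun i => (isCompact_compactCovering Z i).measurableSet) n
  have hfin : ∀ n, ProbabilityTheory.IsSFiniteKernel (κ.restrict (hm n)) := by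
    intro n
    have : ∀ w, IsFiniteMeasure (κ.restrict (hm n) w) := fun w => ⟨by
      rw [ProbabilityTheory.Kernel.restrict_apply, Measure.restrict_apply_univ]
      exact (measure_mono (disjointed_subset _ n)).trans_lt
        (isCompact_compactCovering Z n).measure_lt_top⟩
    exact isSFiniteKernel_of_isFiniteMeasure _
  have hsum : κ = ProbabilityTheory.Kernel.sum fun n => κ.restrict (hm n) := by
    refine ProbabilityTheory.Kernel.ext fun w => ?_
    rw [ProbabilityTheory.Kernel.sum_apply]
    simp_rw [ProbabilityTheory.Kernel.restrict_apply]
    rw [← Measure.restrict_iUnion (disjoint_disjointed _) hm, iUnion_disjointed,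
      iUnion_compactCovering, Measure.restrict_univ]
  rw [hsum]
  infer_instance

/-- A measure on a product that is finite on compact sets is determined by the integrals of the
products `f ⊗ g` with `f` and `g` non-negative, continuous and compactly supported. -/
theorem measure_prod_ext {Z' : Type*} [TopologicalSpace Z'] [T2Space Z'] [LocallyCompactSpace Z']
    [SecondCountableTopology Z'] [MeasurableSpace Z'] [BorelSpace Z'] {μ₁ μ₂ : Measure (Z × Z')}
    [IsFiniteMeasureOnCompacts μ₁]
    (h : ∀ (f : C_c(Z, ℝ)) (g : C_c(Z', ℝ)), (∀ x, 0 ≤ f x) → (∀ x, 0 ≤ g x) →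
      ∫⁻ p, ENNReal.ofReal (f p.1) * ENNReal.ofReal (g p.2) ∂μ₁ =
        ∫⁻ p, ENNReal.ofReal (f p.1) * ENNReal.ofReal (g p.2) ∂μ₂) : μ₁ = μ₂ := by
  have hopen : ∀ U V, IsOpen U → IsOpen V → μ₁ (U ×ˢ V) = μ₂ (U ×ˢ V) := by
    intro U V hU hV
    obtain ⟨f, hf0, hf1, hfs, hf⟩ := exists_seq_cutoff hU
    obtain ⟨g, hg0, hg1, hgs, hg⟩ := exists_seq_cutoff hV
    have key : ∀ μ : Measure (Z × Z'), μ (U ×ˢ V) =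
        liminf (fun n => ∫⁻ p, ENNReal.ofReal (f n p.1) * ENNReal.ofReal (g n p.2) ∂μ) atTop := by
      refine measure_eq_liminf_lintegral (hU.prod hV).measurableSet (fun n => ?_) (fun n p => ?_)
        (fun n p hp => ?_) fun p hp => ?_
      · exact ((measurable_ofReal_coe _).comp measurable_fst).mul
          ((measurable_ofReal_coe _).comp measurable_snd)
      · exact mul_le_one' (ENNReal.ofReal_le_one.2 (hf1 _ _)) (ENNReal.ofReal_le_one.2 (hg1 _ _))
      · by_cases h1 : p.1 ∈ U
        · simp [hgs n p.2 fun h2 => hp ⟨h1, h2⟩]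
        · simp [hfs n p.1 h1]
      · filter_upwards [hf _ hp.1, hg _ hp.2] with n h1 h2
        simp [h1, h2]
    rw [key, key]
    simp_rw [h _ _ (hf0 _) (hg0 _)]
  let E : CompactExhaustion Z := CompactExhaustion.choice Z
  let E' : CompactExhaustion Z' := CompactExhaustion.choice Z'
  refine Measure.ext_of_generateFrom_of_iUnion
    (image2 (· ×ˢ ·) {s : Set Z | IsOpen s} {s : Set Z' | IsOpen s})
    (fun n => interior (E n) ×ˢ interior (E' n)) ?_ (isPiSystem_isOpen.prod isPiSystem_isOpen)
    ?_ (fun n => ⟨_, isOpen_interior, _, isOpen_interior, rfl⟩) (fun n => ?_) ?_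
  · refine (generateFrom_eq_prod ?_ ?_ ⟨fun _ => univ, fun _ => isOpen_univ, iUnion_const _⟩
      ⟨fun _ => univ, fun _ => isOpen_univ, iUnion_const _⟩).symm
    · exact BorelSpace.measurable_eq.symm
    · exact BorelSpace.measurable_eq.symm
  · refine eq_univ_of_forall fun p => ?_
    obtain ⟨n, hn⟩ := E.exists_mem p.1
    obtain ⟨m, hm⟩ := E'.exists_mem p.2
    refine mem_iUnion.2 ⟨max n m + 1, ?_, ?_⟩
    · exact E.subset_interior_succ _ (E.subset (le_max_left _ _) hn)
    · exact E'.subset_interior_succ _ (E'.subset (le_max_right _ _) hm)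
  · exact ((measure_mono (Set.prod_mono interior_subset interior_subset)).trans_lt
      ((E.isCompact n).prod (E'.isCompact n)).measure_lt_top).ne
  · rintro _ ⟨U, hU, V, hV, rfl⟩
    exact hopen U V hU hV

end Vague

section VagueTopology

variable {Z : Type*} [TopologicalSpace Z] [T2Space Z] [LocallyCompactSpace Z]
  [SecondCountableTopology Z] [MeasurableSpace Z] [BorelSpace Z]

omit [T2Space Z] [LocallyCompactSpace Z] [SecondCountableTopology Z] in
theorem integrable_coe (f : C_c(Z, ℝ)) (μ : Measure Z) [IsFiniteMeasureOnCompacts μ] :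
    Integrable f μ := f.continuous.integrable_of_hasCompactSupport f.hasCompactSupport

/-- A countable family of compactly supported functions such that every `f ∈ C_c` is uniformly
close to a member, up to a multiple of a member that dominates the difference. -/
theorem exists_countable_approx (Z : Type*) [TopologicalSpace Z] [T2Space Z]
    [LocallyCompactSpace Z] [SecondCountableTopology Z] :
    ∃ D : Set C_c(Z, ℝ), D.Countable ∧ ∀ f : C_c(Z, ℝ), ∃ χ ∈ D, ∀ ε > 0, ∃ d ∈ D,
      ∀ x, |f x - d x| ≤ ε * χ x := by
  let E : CompactExhaustion Z := CompactExhaustion.choice Z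
  choose χ h0 _ _ h1 using fun n => exists_cutoff (E.isCompact n) isOpen_univ (subset_univ _)
  let A : ℕ → Set C(Z, ℝ) := fun n => {f | ∀ x ∉ E n, f x = 0}
  have hA : ∀ n, ∀ f ∈ A n, HasCompactSupport f := fun n f hf =>
    HasCompactSupport.intro (E.isCompact n) hf
  let ι : ∀ n, A n → C_c(Z, ℝ) := fun n f => ⟨f.1, hA n f.1 f.2⟩
  choose s hsc hsd using fun n => TopologicalSpace.exists_countable_dense (A n)
  refine ⟨⋃ n, insert (χ n) (ι n '' s n),
    countable_iUnion fun n => ((hsc n).image _).insert _, fun f => ?_⟩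
  obtain ⟨n, hn⟩ := E.exists_superset_of_isCompact f.hasCompactSupport
  refine ⟨χ n, mem_iUnion.2 ⟨n, mem_insert _ _⟩, fun ε hε => ?_⟩
  have hf : f.toContinuousMap ∈ A n := fun x hx =>
    image_eq_zero_of_notMem_tsupport fun h => hx (hn h)
  obtain ⟨u, hu, hlim⟩ := mem_closure_iff_seq_limit.1 (hsd n ⟨f.toContinuousMap, hf⟩)
  have hlim' := (continuous_subtype_val.tendsto _).comp hlim
  rw [ContinuousMap.tendsto_iff_forall_isCompact_tendstoUniformlyOn] at hlim'
  obtain ⟨m, hm⟩ := (Metric.tendstoUniformlyOn_iff.1 (hlim' _ (E.isCompact n)) ε hε).exists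
  refine ⟨ι n (u m), mem_iUnion.2 ⟨n, mem_insert_of_mem _ (mem_image_of_mem _ (hu m))⟩,
    fun x => ?_⟩
  by_cases hx : x ∈ E n
  · rw [h1 n x hx, mul_one]
    exact (hm x hx).le
  · have e1 : f x = 0 := hf x hx
    have e2 : ι n (u m) x = 0 := (u m).2 x hx
    rw [e1, e2]
    simpa using mul_nonneg hε.le (h0 n x)

/-- If the topology of `W` is induced by the integrals of the functions in `C_c` against a family
of measures, a map into `W` is Borel measurable as soon as these integrals are measurable: by
separability of `C_c`, countably many integrals induce the topology. -/
theorem measurable_of_measurable_integral {W : Type*} [tW : TopologicalSpace W] [MeasurableSpace W]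
    [BorelSpace W] {M : W → Measure Z} [∀ w, IsFiniteMeasureOnCompacts (M w)]
    (htop : tW = TopologicalSpace.induced (fun w (f : C_c(Z, ℝ)) => ∫ x, f x ∂M w) inferInstance)
    {Ω : Type*} [MeasurableSpace Ω] {T : Ω → W}
    (h : ∀ f : C_c(Z, ℝ), Measurable fun ω => ∫ x, f x ∂M (T ω)) : Measurable T := by
  obtain ⟨D, hD, happ⟩ := exists_countable_approx Z
  have : Countable D := hD.to_subtype
  let I : W → D → ℝ := fun w f => ∫ x, f.1 x ∂M w
  have hI : tW = TopologicalSpace.induced I inferInstance := by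
    refine le_antisymm ?_ ?_
    · rw [← continuous_iff_le_induced]
      refine continuous_pi fun f => ?_
      have : Continuous fun w (f : C_c(Z, ℝ)) => ∫ x, f x ∂M w :=
        continuous_iff_le_induced.2 htop.le
      exact (continuous_apply f.1).comp this
    · rw [htop, ← continuous_iff_le_induced]
      let _ : TopologicalSpace W := TopologicalSpace.induced I inferInstance
      have hc : ∀ d ∈ D, Continuous fun w => ∫ x, d x ∂M w := fun d hd =>
        (continuous_apply (⟨d, hd⟩ : D)).comp (continuous_induced_dom (f := I))
      refine continuous_pi fun f => ?_
      obtain ⟨χ, hχ, hf⟩ := happ f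
      refine continuous_of_locally_uniform_approx_of_continuousAt fun w u hu => ?_
      obtain ⟨ε, hε, hεu⟩ := Metric.mem_uniformity_dist.1 hu
      set m := |∫ x, χ x ∂M w| + 1
      have hm : 0 < m := by positivity
      have hnear : ∀ᶠ w' in 𝓝 w, |∫ x, χ x ∂M w'| < m :=
        (hc χ hχ).abs.tendsto w (Iio_mem_nhds (by simp [m]))
      obtain ⟨d, hd, hfd⟩ := hf (ε / m) (by positivity)
      refine ⟨_, hnear, fun w' => ∫ x, d x ∂M w', (hc d hd).continuousAt, fun w' hw' => hεu ?_⟩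
      rw [Real.dist_eq, ← integral_sub (integrable_coe f _) (integrable_coe d _)]
      calc |∫ x, (f x - d x) ∂M w'| ≤ ∫ x, |f x - d x| ∂M w' := abs_integral_le_integral_abs
        _ ≤ ∫ x, ε / m * χ x ∂M w' := integral_mono
            ((integrable_coe f _).sub (integrable_coe d _)).abs
            ((integrable_coe χ _).const_mul _) hfd
        _ = ε / m * ∫ x, χ x ∂M w' := integral_const_mul _ _
        _ < ε / m * m := mul_lt_mul_of_pos_left ((le_abs_self _).trans_lt hw') (by positivity)
        _ = ε := by field_simp
  -- `D → ℝ` is second countable, so that its Borel sets are generated by the coordinates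
  have hmI : ‹MeasurableSpace W› = MeasurableSpace.comap I inferInstance := by
    rw [BorelSpace.measurable_eq (α := W), hI, BorelSpace.measurable_eq (α := D → ℝ), borel_comap]
  rw [hmI, measurable_comap_iff]
  exact measurable_pi_lambda _ fun f => h f.1

end VagueTopology

/-! ### The counting measure of a configuration -/

section Counting

variable {Y : Type*} [TopologicalSpace Y] [MeasurableSpace Y]

/-- The counting measure `∑_{y ∈ γ} δ_y` of a configuration. -/
def countMeasure (γ : Configuration Y) : Measure Y :=
  Measure.sum fun y : γ.carrier => Measure.dirac (y : Y)

theorem lintegral_countMeasure [MeasurableSingletonClass Y] (γ : Configuration Y) (f : Y → ℝ≥0∞) :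
    ∫⁻ y, f y ∂countMeasure γ = ∑' y : γ.carrier, f y := by
  rw [countMeasure, lintegral_sum_measure]
  simp

variable [T2Space Y] [BorelSpace Y]

instance (γ : Configuration Y) : IsFiniteMeasureOnCompacts (countMeasure γ) where
  lt_top_of_isCompact K hK := by
    rw [countMeasure, Measure.sum_apply _ hK.measurableSet]
    have hfin : {y : γ.carrier | (y : Y) ∈ K}.Finite := by
      refine Set.Finite.of_finite_image (f := Subtype.val) ?_ Subtype.val_injective.injOn
      refine (γ.locallyFinite K hK).subset ?_
      rintro _ ⟨y, hy, rfl⟩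
      exact ⟨y.2, hy⟩
    rw [tsum_eq_sum (s := hfin.toFinset)]
    · refine ENNReal.sum_lt_top.2 fun y _ => measure_lt_top _ _
    · intro y hy
      have : (y : Y) ∉ K := fun h => hy (hfin.mem_toFinset.2 h)
      simp [Measure.dirac_apply' _ hK.measurableSet, this]

theorem integral_countMeasure {γ : Configuration Y} {f : Y → ℝ}
    (hf : Integrable f (countMeasure γ)) : ∫ y, f y ∂countMeasure γ = ∑' y : γ.carrier, f y := by
  rw [countMeasure] at hf ⊢
  rw [integral_sum_measure hf]
  simp

theorem integral_countMeasure_coe [LocallyCompactSpace Y] [SecondCountableTopology Y]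
    (γ : Configuration Y) (f : C_c(Y, ℝ)) : ∫ y, f y ∂countMeasure γ = γ.pairing f :=
  integral_countMeasure (integrable_coe f _)

end Counting

section CountKernel

open ProbabilityTheory

variable {Y : Type*} [TopologicalSpace Y] [T2Space Y] [LocallyCompactSpace Y]
  [SecondCountableTopology Y] [MeasurableSpace Y] [BorelSpace Y]

omit [T2Space Y] [LocallyCompactSpace Y] [SecondCountableTopology Y] [MeasurableSpace Y]
  [BorelSpace Y] in
theorem measurable_pairing (f : C_c(Y, ℝ)) :
    Measurable fun γ : Configuration Y => γ.pairing f := by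
  have : Continuous fun (γ : Configuration Y) (f : C_c(Y, ℝ)) => γ.pairing f :=
    continuous_induced_dom
  exact ((continuous_apply f).comp this).measurable

/-- A map into the configurations is measurable if all its pairings with `f ∈ C_c` are. -/
theorem measurable_configuration {Ω : Type*} [MeasurableSpace Ω] {T : Ω → Configuration Y}
    (h : ∀ f : C_c(Y, ℝ), Measurable fun ω => (T ω).pairing f) : Measurable T := by
  refine measurable_of_measurable_integral (M := countMeasure) ?_ fun f => ?_
  · simp_rw [integral_countMeasure_coe]
    rfl
  · simpa only [integral_countMeasure_coe] using h f

theorem lintegral_countMeasure_coe (γ : Configuration Y) {f : C_c(Y, ℝ)} (hf : ∀ y, 0 ≤ f y) :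
    ∫⁻ y, ENNReal.ofReal (f y) ∂countMeasure γ = ENNReal.ofReal (γ.pairing f) := by
  rw [← integral_countMeasure_coe,
    ofReal_integral_eq_lintegral_ofReal (integrable_coe f _) (Eventually.of_forall hf)]

/-- The counting measures of configurations as a kernel. -/
def countKernel (Y : Type*) [TopologicalSpace Y] [T2Space Y] [LocallyCompactSpace Y]
    [SecondCountableTopology Y] [MeasurableSpace Y] [BorelSpace Y] :
    Kernel (Configuration Y) Y where
  toFun := countMeasure
  measurable' := measurable_measure_of_lintegral fun f hf => by
    simp_rw [lintegral_countMeasure_coe _ hf]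
    exact (measurable_pairing f).ennreal_ofReal

theorem countKernel_apply (γ : Configuration Y) : countKernel Y γ = countMeasure γ := rfl

instance : IsSFiniteKernel (countKernel Y) :=
  have : ∀ γ, IsFiniteMeasureOnCompacts (countKernel Y γ) := fun γ =>
    inferInstanceAs (IsFiniteMeasureOnCompacts (countMeasure γ))
  isSFiniteKernel_of_isFiniteMeasureOnCompacts _

theorem pairing_add (γ : Configuration Y) (f g : C_c(Y, ℝ)) :
    γ.pairing (f + g) = γ.pairing f + γ.pairing g := by
  simp_rw [← integral_countMeasure_coe]
  exact integral_add (integrable_coe f _) (integrable_coe g _)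

theorem pairing_smul (γ : Configuration Y) (c : ℝ) (f : C_c(Y, ℝ)) :
    γ.pairing (c • f) = c * γ.pairing f := by
  simp_rw [← integral_countMeasure_coe]
  exact integral_const_mul _ _

theorem pairing_sub (γ : Configuration Y) (f g : C_c(Y, ℝ)) :
    γ.pairing (f - g) = γ.pairing f - γ.pairing g := by
  simp_rw [← integral_countMeasure_coe]
  exact integral_sub (integrable_coe f _) (integrable_coe g _)

theorem pairing_sum {ι : Type*} (s : Finset ι) (γ : Configuration Y) (f : ι → C_c(Y, ℝ)) :
    γ.pairing (∑ i ∈ s, f i) = ∑ i ∈ s, γ.pairing (f i) := by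
  simp_rw [← integral_countMeasure_coe, CompactlySupportedContinuousMap.sum_apply]
  exact integral_finsetSum _ fun i _ => integrable_coe (f i) _

omit [T2Space Y] [LocallyCompactSpace Y] [SecondCountableTopology Y] [MeasurableSpace Y]
  [BorelSpace Y] in
theorem pairing_nonneg (γ : Configuration Y) {f : C_c(Y, ℝ)} (hf : ∀ y, 0 ≤ f y) :
    0 ≤ γ.pairing f := tsum_nonneg fun y => hf y

end CountKernel

/-! ### Laplace transforms -/

section Laplace

open ProbabilityTheory

/-- A finite measure on the orthant `[0, ∞)^ι` is determined by its Laplace transform: the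
exponentials span an algebra that separates points. -/
theorem measure_ext_of_laplace {ι : Type*} [Fintype ι] {P₁ P₂ : Measure (ι → NNReal)}
    [IsFiniteMeasure P₁] [IsFiniteMeasure P₂]
    (h : ∀ t : ι → NNReal, ∫ v, Real.exp (-∑ i, (t i : ℝ) * v i) ∂P₁ =
      ∫ v, Real.exp (-∑ i, (t i : ℝ) * v i) ∂P₂) : P₁ = P₂ := by
  classical
  let e : (ι → NNReal) → (ι → NNReal) →ᵇ ℝ := fun t =>
    BoundedContinuousFunction.ofNormedAddCommGroup
      (fun v => Real.exp (-∑ i, (t i : ℝ) * v i)) (by fun_prop) 1 fun v => by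
        rw [Real.norm_eq_abs, Real.abs_exp]
        exact Real.exp_le_one_iff.2 (neg_nonpos.2 (by positivity))
  let S : Submonoid ((ι → NNReal) →ᵇ ℝ) :=
    { carrier := range e
      one_mem' := ⟨0, by ext v; simp [e]⟩
      mul_mem' := by
        rintro _ _ ⟨s, rfl⟩ ⟨t, rfl⟩
        refine ⟨s + t, ?_⟩
        ext v
        simp [e, ← Real.exp_add, add_mul, Finset.sum_add_distrib, add_comm] }
  let A : StarSubalgebra ℝ ((ι → NNReal) →ᵇ ℝ) :=
    { Algebra.adjoin ℝ (S : Set ((ι → NNReal) →ᵇ ℝ)) with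
      star_mem' := fun {a} ha => by
        rwa [show star a = a by ext; simp] }
  refine ext_of_forall_mem_subalgebra_integral_eq_of_polish (A := A) ?_ fun g hg => ?_
  · intro v w hvw
    obtain ⟨i, hi⟩ := Function.ne_iff.1 hvw
    refine ⟨e (Pi.single i 1), ⟨_, ⟨e (Pi.single i 1), Algebra.subset_adjoin ⟨_, rfl⟩, rfl⟩, rfl⟩,
      ?_⟩
    have hs : ∀ u : ι → NNReal, ∑ j, ((Pi.single i 1 : ι → NNReal) j : ℝ) * u j = u i := fun u => by
      rw [Finset.sum_eq_single i (fun j _ hj => by simp [hj]) (by simp)]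
      simp
    change Real.exp _ ≠ Real.exp _
    rw [hs, hs, Real.exp_injective.ne_iff, neg_injective.ne_iff]
    exact_mod_cast hi
  · have hg' : g ∈ Submodule.span ℝ (S : Set ((ι → NNReal) →ᵇ ℝ)) := by
      have : g ∈ Subalgebra.toSubmodule (Algebra.adjoin ℝ (S : Set ((ι → NNReal) →ᵇ ℝ))) := hg
      rwa [Algebra.adjoin_eq_span, Submonoid.closure_eq] at this
    clear hg
    induction hg' using Submodule.span_induction with
    | mem x hx =>
      obtain ⟨t, rfl⟩ := hx
      exact h t
    | zero => simp
    | add x y _ _ hx hy =>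
      simp only [BoundedContinuousFunction.coe_add, Pi.add_apply]
      rw [integral_add (x.integrable _) (y.integrable _),
        integral_add (x.integrable _) (y.integrable _), hx, hy]
    | smul c x _ hx =>
      simp only [BoundedContinuousFunction.coe_smul]
      rw [integral_smul, integral_smul, hx]

end Laplace

/-! ### The Mecke identity -/

section Mecke

open ProbabilityTheory

variable {Y : Type*} [TopologicalSpace Y] [T2Space Y] [LocallyCompactSpace Y]
  [SecondCountableTopology Y] [MeasurableSpace Y] [BorelSpace Y] {m : Measure Y}
  [IsLocallyFiniteMeasure m] {π : Measure (Configuration Y)}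

/-- The derivative at `0` of the logarithm of the Laplace transform in the direction `f`. -/
theorem hasDerivAt_integral_exp_sub_one (m : Measure Y) [IsLocallyFiniteMeasure m]
    (h f : C_c(Y, ℝ)) :
    HasDerivAt (fun t : ℝ => ∫ y, (Real.exp (-(h y + t * f y)) - 1) ∂m)
      (-∫ y, f y * Real.exp (-h y) ∂m) 0 := by
  have hsupp : ∀ t : ℝ, HasCompactSupport fun y => Real.exp (-(h y + t * f y)) - 1 := fun t => by
    refine HasCompactSupport.intro (h.hasCompactSupport.union f.hasCompactSupport) fun y hy => ?_
    rw [image_eq_zero_of_notMem_tsupport fun h1 => hy (Or.inl h1),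
      image_eq_zero_of_notMem_tsupport fun h1 => hy (Or.inr h1)]
    simp
  have key := hasDerivAt_integral_of_dominated_loc_of_deriv_le (μ := m) (x₀ := (0 : ℝ))
    (s := Metric.ball (0 : ℝ) 1)
    (F := fun t y => Real.exp (-(h y + t * f y)) - 1)
    (F' := fun t y => -f y * Real.exp (-(h y + t * f y)))
    (bound := fun y => |f y| * Real.exp (-h y + |f y|)) (Metric.ball_mem_nhds _ one_pos)
    (Eventually.of_forall fun t => Continuous.aestronglyMeasurable (by fun_prop))
    (Continuous.integrable_of_hasCompactSupport (by fun_prop) (hsupp 0))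
    (Continuous.aestronglyMeasurable (by fun_prop)) ?_ ?_ ?_
  · refine key.2.congr_deriv ?_
    rw [← integral_neg]
    simp
  · refine Eventually.of_forall fun y t ht => ?_
    rw [norm_mul, norm_neg, Real.norm_eq_abs, Real.norm_eq_abs, Real.abs_exp]
    gcongr
    rw [neg_add]
    gcongr
    calc -(t * f y) ≤ |t * f y| := neg_le_abs _
      _ = |t| * |f y| := abs_mul _ _
      _ ≤ 1 * |f y| := by
        gcongr
        simpa using (mem_ball_zero_iff.1 ht).le
      _ = |f y| := one_mul _
  · refine Continuous.integrable_of_hasCompactSupport (by fun_prop) ?_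
    exact f.hasCompactSupport.norm.mul_right
  · refine Eventually.of_forall fun y t _ => ?_
    have h1 : HasDerivAt (fun t : ℝ => -(h y + t * f y)) (-f y) t := by
      simpa using (((hasDerivAt_id t).mul_const (f y)).const_add (h y)).fun_neg
    have h2 := (h1.exp.sub_const 1)
    exact h2.congr_deriv (mul_comm _ _)

/-- `2 ^ n * (1 - exp (-a / 2 ^ n))` increases to `a ≥ 0`. -/
theorem monotone_pow_mul_one_sub_exp (a : ℝ) :
    Monotone fun n : ℕ => 2 ^ n * (1 - Real.exp (-((2 ^ n)⁻¹ * a))) := by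
  refine monotone_nat_of_le_succ fun n => ?_
  set u := Real.exp (-((2 ^ (n + 1))⁻¹ * a)) with hu
  have hsq : Real.exp (-((2 ^ n)⁻¹ * a)) = u ^ 2 := by
    rw [hu, ← Real.exp_nat_mul]
    congr 1
    rw [pow_succ]
    push_cast
    field_simp
  rw [hsq, pow_succ 2 n, mul_assoc]
  gcongr
  nlinarith [sq_nonneg (1 - u)]

theorem tendsto_inv_two_pow : Tendsto (fun n : ℕ => ((2 : ℝ) ^ n)⁻¹) atTop (𝓝[≠] 0) := by
  refine tendsto_nhdsWithin_iff.2 ⟨?_, Eventually.of_forall fun n => by simp⟩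
  simp_rw [← inv_pow]
  exact tendsto_pow_atTop_nhds_zero_of_lt_one (by norm_num) (by norm_num)

theorem tendsto_pow_mul_one_sub_exp (a : ℝ) :
    Tendsto (fun n : ℕ => 2 ^ n * (1 - Real.exp (-((2 ^ n)⁻¹ * a)))) atTop (𝓝 a) := by
  have h1 : HasDerivAt (fun t : ℝ => -Real.exp (-(t * a))) a 0 := by
    have := ((hasDerivAt_id (0 : ℝ)).mul_const a).fun_neg.exp.fun_neg
    simpa using this
  have := (hasDerivAt_iff_tendsto_slope_zero.1 h1).comp tendsto_inv_two_pow
  refine this.congr fun n => ?_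
  simp
  ring

/-- Differentiating the Laplace transform along `f`: `E[⟨γ, f⟩ exp (-⟨γ, h⟩)]`. -/
theorem IsPoissonMeasure.lintegral_pairing_mul_exp (hπ : IsPoissonMeasure m π) {f h : C_c(Y, ℝ)}
    (hf : ∀ y, 0 ≤ f y) (hh : ∀ y, 0 ≤ h y) :
    ∫⁻ γ, ENNReal.ofReal (γ.pairing f * Real.exp (-γ.pairing h)) ∂π =
      ENNReal.ofReal ((∫ y, f y * Real.exp (-h y) ∂m) *
        Real.exp (∫ y, (Real.exp (-h y) - 1) ∂m)) := by
  have := hπ.isProbabilityMeasure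
  let Λ : ℝ → ℝ := fun t => Real.exp (∫ y, (Real.exp (-(h y + t * f y)) - 1) ∂m)
  have hΛ : ∀ t, 0 ≤ t → ∫ γ, Real.exp (-(γ.pairing h + t * γ.pairing f)) ∂π = Λ t := by
    intro t ht
    have := hπ.laplace (h + t • f) fun y => add_nonneg (hh y) (mul_nonneg ht (hf y))
    simp only [pairing_add, pairing_smul] at this
    exact this
  have hint : ∀ t, 0 ≤ t → Integrable (fun γ => Real.exp (-(γ.pairing h + t * γ.pairing f))) π := by
    intro t ht
    refine Integrable.of_bound (C := 1) ?_ (Eventually.of_forall fun γ => ?_)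
    · exact (((measurable_pairing h).add
        ((measurable_pairing f).const_mul t)).neg.exp).aestronglyMeasurable
    · rw [Real.norm_eq_abs, Real.abs_exp]
      exact Real.exp_le_one_iff.2 (neg_nonpos.2 (add_nonneg (pairing_nonneg γ hh)
        (mul_nonneg ht (pairing_nonneg γ hf))))
  have hderiv : HasDerivAt Λ (-((∫ y, f y * Real.exp (-h y) ∂m) *
      Real.exp (∫ y, (Real.exp (-h y) - 1) ∂m))) 0 := by
    have := (hasDerivAt_integral_exp_sub_one m h f).exp
    refine this.congr_deriv ?_
    simp
    ring
  have hlim : Tendsto (fun n : ℕ => ENNReal.ofReal (2 ^ n * (Λ 0 - Λ (2 ^ n)⁻¹))) atTop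
      (𝓝 (ENNReal.ofReal ((∫ y, f y * Real.exp (-h y) ∂m) *
        Real.exp (∫ y, (Real.exp (-h y) - 1) ∂m)))) := by
    refine (ENNReal.continuous_ofReal.tendsto _).comp ?_
    have := ((hasDerivAt_iff_tendsto_slope_zero.1 hderiv).comp tendsto_inv_two_pow).neg
    rw [neg_neg] at this
    refine this.congr fun n => ?_
    simp
    ring
  -- Along dyadic steps the difference quotients of `t ↦ exp (-⟨γ, h + t f⟩)` at `0` are monotone,
  -- so that no integrability of `⟨γ, f⟩` is needed.
  let a : ℕ → Configuration Y → ℝ := fun n γ =>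
    Real.exp (-γ.pairing h) * (2 ^ n * (1 - Real.exp (-((2 ^ n)⁻¹ * γ.pairing f))))
  have ha0 : ∀ n γ, 0 ≤ a n γ := fun n γ => by
    have : Real.exp (-((2 ^ n)⁻¹ * γ.pairing f)) ≤ 1 := Real.exp_le_one_iff.2
      (neg_nonpos.2 (mul_nonneg (by positivity) (pairing_nonneg γ hf)))
    exact mul_nonneg (Real.exp_nonneg _) (mul_nonneg (by positivity) (sub_nonneg.2 this))
  have haeq : ∀ n, a n = fun γ => 2 ^ n * (Real.exp (-(γ.pairing h + 0 * γ.pairing f)) -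
      Real.exp (-(γ.pairing h + (2 ^ n)⁻¹ * γ.pairing f))) := fun n => funext fun γ => by
    simp only [a]
    rw [neg_add, neg_add, Real.exp_add, Real.exp_add]
    simp
    ring
  have hai : ∀ n, Integrable (a n) π := fun n => by
    rw [haeq]
    exact ((hint 0 le_rfl).sub (hint _ (by positivity))).const_mul _
  have hval : ∀ n, ∫⁻ γ, ENNReal.ofReal (a n γ) ∂π =
      ENNReal.ofReal (2 ^ n * (Λ 0 - Λ (2 ^ n)⁻¹)) := fun n => by
    rw [← ofReal_integral_eq_lintegral_ofReal (hai n) (Eventually.of_forall (ha0 n)), haeq,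
      integral_const_mul, integral_sub (hint 0 le_rfl) (hint _ (by positivity)), hΛ 0 le_rfl,
      hΛ _ (by positivity)]
  refine tendsto_nhds_unique ?_ (hlim.congr fun n => (hval n).symm)
  refine lintegral_tendsto_of_tendsto_of_monotone
    (fun n => (hai n).aestronglyMeasurable.aemeasurable.ennreal_ofReal)
    (Eventually.of_forall fun γ i j hij => ?_) (Eventually.of_forall fun γ => ?_)
  · exact ENNReal.ofReal_le_ofReal (mul_le_mul_of_nonneg_left
      (monotone_pow_mul_one_sub_exp _ hij) (Real.exp_nonneg _))
  · refine (ENNReal.continuous_ofReal.tendsto _).comp ?_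
    rw [mul_comm]
    exact (tendsto_pow_mul_one_sub_exp _).const_mul _

end Mecke

section MeckeIdentity

open ProbabilityTheory

variable {Y : Type*} [TopologicalSpace Y] [T2Space Y] [LocallyCompactSpace Y]
  [SecondCountableTopology Y] [MeasurableSpace Y] [BorelSpace Y] {m : Measure Y}
  [IsLocallyFiniteMeasure m] {π : Measure (Configuration Y)}

/-- The Mecke identity for the functionals `f(y) exp (-⟨γ, h⟩)`. -/
theorem IsPoissonMeasure.lintegral_exp (hπ : IsPoissonMeasure m π) {f h : C_c(Y, ℝ)}
    (hf : ∀ y, 0 ≤ f y) (hh : ∀ y, 0 ≤ h y) :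
    ∫⁻ γ, ∫⁻ y, ENNReal.ofReal (f y) * ENNReal.ofReal (Real.exp (-γ.pairing h)) ∂countMeasure γ ∂π =
      ∫⁻ γ, ∫⁻ y, ENNReal.ofReal (f y) *
        ENNReal.ofReal (Real.exp (-(γ.pairing h + h y))) ∂m ∂π := by
  have := hπ.isProbabilityMeasure
  have hint : Integrable (fun γ => Real.exp (-γ.pairing h)) π := by
    refine Integrable.of_bound (C := 1) (measurable_pairing h).neg.exp.aestronglyMeasurable
      (Eventually.of_forall fun γ => ?_)
    rw [Real.norm_eq_abs, Real.abs_exp]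
    exact Real.exp_le_one_iff.2 (neg_nonpos.2 (pairing_nonneg γ hh))
  have hint' : Integrable (fun y => f y * Real.exp (-h y)) m :=
    Continuous.integrable_of_hasCompactSupport (by fun_prop) f.hasCompactSupport.mul_right
  have hl : ∀ γ : Configuration Y,
      ∫⁻ y, ENNReal.ofReal (f y) * ENNReal.ofReal (Real.exp (-γ.pairing h)) ∂countMeasure γ =
        ENNReal.ofReal (γ.pairing f * Real.exp (-γ.pairing h)) := fun γ => by
    rw [lintegral_mul_const _ (measurable_ofReal_coe f), lintegral_countMeasure_coe γ hf,
      ENNReal.ofReal_mul (pairing_nonneg γ hf)]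
  have hr : ∀ γ : Configuration Y,
      ∫⁻ y, ENNReal.ofReal (f y) * ENNReal.ofReal (Real.exp (-(γ.pairing h + h y))) ∂m =
        ENNReal.ofReal (∫ y, f y * Real.exp (-h y) ∂m) *
          ENNReal.ofReal (Real.exp (-γ.pairing h)) := fun γ => by
    rw [ofReal_integral_eq_lintegral_ofReal hint' (Eventually.of_forall fun y =>
      mul_nonneg (hf y) (Real.exp_nonneg _)), ← lintegral_mul_const _ (by fun_prop)]
    refine lintegral_congr fun y => ?_
    rw [← ENNReal.ofReal_mul (hf y), ← ENNReal.ofReal_mul (mul_nonneg (hf y) (Real.exp_nonneg _)),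
      neg_add, Real.exp_add]
    ring_nf
  simp_rw [hl, hr]
  rw [hπ.lintegral_pairing_mul_exp hf hh, lintegral_const_mul _ (by
      exact (measurable_pairing h).neg.exp.ennreal_ofReal),
    ← ofReal_integral_eq_lintegral_ofReal hint (Eventually.of_forall fun γ => Real.exp_nonneg _),
    hπ.laplace h hh, ENNReal.ofReal_mul (integral_nonneg fun y =>
      mul_nonneg (hf y) (Real.exp_nonneg _))]

variable {ι : Type*} [Fintype ι]

/-- The law of `(⟨γ, φ⟩, y)`, with `y` a point of `γ`, under the Campbell measure of `π`. -/
def campbellLaw (π : Measure (Configuration Y)) (φ : ι → C_c(Y, ℝ)) : Measure ((ι → ℝ) × Y) :=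
  (π ⊗ₘ countKernel Y).map fun p => (fun i => p.1.pairing (φ i), p.2)

/-- The law of `(⟨γ + δ_y, φ⟩, y)` under `π ⊗ m`. -/
def birthLaw (m : Measure Y) (π : Measure (Configuration Y)) (φ : ι → C_c(Y, ℝ)) :
    Measure ((ι → ℝ) × Y) :=
  (π.prod m).map fun p => (fun i => p.1.pairing (φ i) + φ i p.2, p.2)

omit [T2Space Y] [LocallyCompactSpace Y] [SecondCountableTopology Y] [BorelSpace Y] [Fintype ι] in
theorem measurable_pairing_prod (φ : ι → C_c(Y, ℝ)) :
    Measurable fun p : Configuration Y × Y => ((fun i => p.1.pairing (φ i) : ι → ℝ), p.2) :=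
  (measurable_pi_lambda _ fun i => (measurable_pairing (φ i)).comp measurable_fst).prodMk
    measurable_snd

omit [T2Space Y] [LocallyCompactSpace Y] [SecondCountableTopology Y] [Fintype ι] in
theorem measurable_pairing_add_prod (φ : ι → C_c(Y, ℝ)) :
    Measurable fun p : Configuration Y × Y =>
      ((fun i => p.1.pairing (φ i) + φ i p.2 : ι → ℝ), p.2) :=
  (measurable_pi_lambda _ fun i => ((measurable_pairing (φ i)).comp measurable_fst).add
    ((φ i).continuous.measurable.comp measurable_snd)).prodMk measurable_snd

omit [Fintype ι] in
theorem lintegral_campbellLaw [SFinite π] (φ : ι → C_c(Y, ℝ)) {Φ : (ι → ℝ) × Y → ℝ≥0∞}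
    (hΦ : Measurable Φ) : ∫⁻ p, Φ p ∂campbellLaw π φ =
      ∫⁻ γ, ∫⁻ y, Φ (fun i => γ.pairing (φ i), y) ∂countMeasure γ ∂π := by
  rw [campbellLaw, lintegral_map hΦ (measurable_pairing_prod φ)]
  exact Measure.lintegral_compProd (hΦ.comp (measurable_pairing_prod φ))

omit [T2Space Y] [LocallyCompactSpace Y] [Fintype ι] in
theorem lintegral_birthLaw [SFinite π] (φ : ι → C_c(Y, ℝ)) {Φ : (ι → ℝ) × Y → ℝ≥0∞}
    (hΦ : Measurable Φ) : ∫⁻ p, Φ p ∂birthLaw m π φ =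
      ∫⁻ γ, ∫⁻ y, Φ (fun i => γ.pairing (φ i) + φ i y, y) ∂m ∂π := by
  rw [birthLaw, lintegral_map hΦ (measurable_pairing_add_prod φ)]
  exact lintegral_prod _ (hΦ.comp (measurable_pairing_add_prod φ)).aemeasurable

instance [IsProbabilityMeasure π] (φ : ι → C_c(Y, ℝ)) :
    IsFiniteMeasureOnCompacts (birthLaw m π φ) where
  lt_top_of_isCompact K hK := by
    rw [birthLaw, Measure.map_apply (measurable_pairing_add_prod φ) hK.measurableSet]
    have hK' : IsCompact (Prod.snd '' K) := hK.image continuous_snd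
    have hsub : (fun p : Configuration Y × Y =>
        ((fun i => p.1.pairing (φ i) + φ i p.2 : ι → ℝ), p.2)) ⁻¹' K ⊆ univ ×ˢ (Prod.snd '' K) :=
      fun p hp => ⟨mem_univ _, ⟨_, hp, rfl⟩⟩
    refine (measure_mono hsub).trans_lt ?_
    rw [Measure.prod_prod, measure_univ, one_mul]
    exact hK'.measure_lt_top

/-- The Mecke identity for non-negative `φ`: weighting with `f(y)` leaves finite measures on the
orthant, which have the same Laplace transform. -/
theorem IsPoissonMeasure.campbellLaw_eq_of_nonneg (hπ : IsPoissonMeasure m π) (φ : ι → C_c(Y, ℝ))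
    (hφ : ∀ i y, 0 ≤ φ i y) : campbellLaw π φ = birthLaw m π φ := by
  have := hπ.isProbabilityMeasure
  symm
  refine measure_prod_ext fun g f hg hf => ?_
  let q : (ι → ℝ) × Y → (ι → NNReal) := fun p i => (p.1 i).toNNReal
  have hq : Measurable q := measurable_pi_lambda _ fun i =>
    ((measurable_pi_apply i).comp measurable_fst).real_toNNReal
  have hfm : Measurable fun p : (ι → ℝ) × Y => ENNReal.ofReal (f p.2) :=
    (measurable_ofReal_coe f).comp measurable_snd
  let Q : Measure ((ι → ℝ) × Y) → Measure (ι → NNReal) := fun C =>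
    (C.withDensity fun p => ENNReal.ofReal (f p.2)).map q
  have hQ : ∀ (C : Measure ((ι → ℝ) × Y)) {u : (ι → NNReal) → ℝ≥0∞}, Measurable u →
      ∫⁻ v, u v ∂Q C = ∫⁻ p, ENNReal.ofReal (f p.2) * u (q p) ∂C := by
    intro C u hu
    rw [lintegral_map hu hq]
    exact lintegral_withDensity_eq_lintegral_mul _ hfm (hu.comp hq)
  -- both laws charge only the orthant
  have hC : ∀ {u : (ι → ℝ) × Y → (ι → ℝ) × Y → ℝ≥0∞}, Measurable (fun p => u p p) →
      Measurable (fun p => u p (fun i => ((p.1 i).toNNReal : ℝ), p.2)) →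
      (∫⁻ p, u p p ∂campbellLaw π φ =
        ∫⁻ p, u p (fun i => ((p.1 i).toNNReal : ℝ), p.2) ∂campbellLaw π φ) ∧
      ∫⁻ p, u p p ∂birthLaw m π φ =
        ∫⁻ p, u p (fun i => ((p.1 i).toNNReal : ℝ), p.2) ∂birthLaw m π φ := by
    intro u hu hu'
    have e1 : ∀ (γ : Configuration Y) i, max (γ.pairing (φ i)) 0 = γ.pairing (φ i) := fun γ i =>
      max_eq_left (pairing_nonneg γ (hφ i))
    have e2 : ∀ (γ : Configuration Y) i y,
        max (γ.pairing (φ i) + φ i y) 0 = γ.pairing (φ i) + φ i y := fun γ i y =>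
      max_eq_left (add_nonneg (pairing_nonneg γ (hφ i)) (hφ i y))
    constructor
    · rw [lintegral_campbellLaw φ hu, lintegral_campbellLaw φ hu']
      simp_rw [Real.coe_toNNReal', e1]
    · rw [lintegral_birthLaw φ hu, lintegral_birthLaw φ hu']
      simp_rw [Real.coe_toNNReal', e2]
  have hexp : ∀ t : ι → NNReal,
      ∫⁻ v, ENNReal.ofReal (Real.exp (-∑ i, (t i : ℝ) * v i)) ∂Q (campbellLaw π φ) =
        ∫⁻ v, ENNReal.ofReal (Real.exp (-∑ i, (t i : ℝ) * v i)) ∂Q (birthLaw m π φ) := by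
    intro t
    have hm1 : Measurable fun v : ι → NNReal =>
      ENNReal.ofReal (Real.exp (-∑ i, (t i : ℝ) * v i)) := by fun_prop
    have hm2 : Measurable fun p : (ι → ℝ) × Y =>
      ENNReal.ofReal (f p.2) * ENNReal.ofReal (Real.exp (-∑ i, (t i : ℝ) * p.1 i)) :=
        hfm.mul (by fun_prop)
    have hm3 : Measurable fun p : (ι → ℝ) × Y => ENNReal.ofReal (f p.2) *
        ENNReal.ofReal (Real.exp (-∑ i, (t i : ℝ) * ((p.1 i).toNNReal : ℝ))) :=
        hfm.mul (by fun_prop)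
    obtain ⟨h1, h2⟩ := hC (u := fun p p' => ENNReal.ofReal (f p.2) *
      ENNReal.ofReal (Real.exp (-∑ i, (t i : ℝ) * p'.1 i))) hm2 hm3
    rw [hQ _ hm1, hQ _ hm1]
    refine h1.symm.trans (Eq.trans ?_ h2)
    rw [lintegral_campbellLaw φ hm2, lintegral_birthLaw φ hm2]
    have hh : ∀ y, 0 ≤ (∑ i, (t i : ℝ) • φ i) y := fun y => by
      rw [CompactlySupportedContinuousMap.sum_apply]
      exact Finset.sum_nonneg fun i _ => mul_nonneg (t i).2 (hφ i y)
    have := hπ.lintegral_exp hf hh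
    simpa only [pairing_sum, pairing_smul, CompactlySupportedContinuousMap.sum_apply,
      CompactlySupportedContinuousMap.smul_apply, smul_eq_mul, mul_add, Finset.sum_add_distrib]
      using this
  -- the total mass of `Q` is `∫ f dm`; for the Campbell law it is the case `t = 0` of `hexp`
  have hfin : Q (birthLaw m π φ) univ < ∞ := by
    rw [← lintegral_one, hQ _ measurable_const, lintegral_birthLaw φ (by simpa using hfm)]
    simp only [mul_one, lintegral_const, measure_univ]
    exact (integrable_coe f m).lintegral_lt_top
  have hfin' : Q (campbellLaw π φ) univ < ∞ := by
    have := hexp 0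
    simp only [Pi.zero_apply, NNReal.coe_zero, zero_mul, Finset.sum_const_zero, neg_zero,
      Real.exp_zero, ENNReal.ofReal_one, lintegral_one] at this
    rwa [this]
  have : IsFiniteMeasure (Q (birthLaw m π φ)) := ⟨hfin⟩
  have : IsFiniteMeasure (Q (campbellLaw π φ)) := ⟨hfin'⟩
  have hQQ : Q (campbellLaw π φ) = Q (birthLaw m π φ) := by
    refine measure_ext_of_laplace fun t => ?_
    have hm : Measurable fun v : ι → NNReal => Real.exp (-∑ i, (t i : ℝ) * v i) := by fun_prop
    rw [integral_eq_lintegral_of_nonneg_ae (Eventually.of_forall fun v => Real.exp_nonneg _)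
      hm.aestronglyMeasurable, integral_eq_lintegral_of_nonneg_ae
      (Eventually.of_forall fun v => Real.exp_nonneg _) hm.aestronglyMeasurable, hexp t]
  have hm1 : Measurable fun v : ι → NNReal => ENNReal.ofReal (g fun i => (v i : ℝ)) :=
    (measurable_ofReal_coe g).comp (by fun_prop)
  have hm2 : Measurable fun p : (ι → ℝ) × Y => ENNReal.ofReal (g p.1) * ENNReal.ofReal (f p.2) :=
    ((measurable_ofReal_coe g).comp measurable_fst).mul hfm
  have hm3 : Measurable fun p : (ι → ℝ) × Y =>
      ENNReal.ofReal (g fun i => ((p.1 i).toNNReal : ℝ)) * ENNReal.ofReal (f p.2) :=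
    ((measurable_ofReal_coe g).comp (by fun_prop)).mul hfm
  obtain ⟨h1, h2⟩ := hC (u := fun p p' => ENNReal.ofReal (g p'.1) * ENNReal.ofReal (f p.2)) hm2 hm3
  rw [h1, h2]
  simp_rw [mul_comm (ENNReal.ofReal (g _))]
  exact ((hQ _ hm1).symm.trans (by rw [hQQ])).trans (hQ _ hm1)

/-- The Mecke identity: adding a point of intensity `m` to a Poisson configuration gives the
Campbell measure. -/
theorem IsPoissonMeasure.campbellLaw_eq (hπ : IsPoissonMeasure m π) (φ : ι → C_c(Y, ℝ)) :
    campbellLaw π φ = birthLaw m π φ := by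
  have := hπ.isProbabilityMeasure
  -- split every `φ i` into its positive and negative parts
  let ψ : ι ⊕ ι → C_c(Y, ℝ) := Sum.elim (fun i => φ i ⊔ 0) fun i => -φ i ⊔ 0
  have hψ : ∀ i y, 0 ≤ ψ i y := by rintro (i | i) y <;> simp [ψ]
  have hφ : ∀ i, φ i = ψ (Sum.inl i) - ψ (Sum.inr i) := fun i => by
    ext y
    simp only [ψ, Sum.elim_inl, Sum.elim_inr, CompactlySupportedContinuousMap.sub_apply,
      CompactlySupportedContinuousMap.sup_apply, CompactlySupportedContinuousMap.neg_apply,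
      CompactlySupportedContinuousMap.zero_apply]
    exact (max_zero_sub_max_neg_zero_eq_self (φ i y)).symm
  let d : (ι ⊕ ι → ℝ) × Y → (ι → ℝ) × Y := fun p =>
    (fun i => p.1 (Sum.inl i) - p.1 (Sum.inr i), p.2)
  have hd : Measurable d := by fun_prop
  have h1 : campbellLaw π φ = (campbellLaw π ψ).map d := by
    rw [campbellLaw, campbellLaw, Measure.map_map hd (measurable_pairing_prod ψ)]
    congr 1
    funext p
    simp only [Function.comp, d, hφ, pairing_sub]
  have h2 : birthLaw m π φ = (birthLaw m π ψ).map d := by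
    rw [birthLaw, birthLaw, Measure.map_map hd (measurable_pairing_add_prod ψ)]
    congr 1
    funext p
    refine Prod.ext (funext fun i => ?_) rfl
    simp only [Function.comp, d]
    rw [hφ i, pairing_sub, CompactlySupportedContinuousMap.sub_apply]
    ring
  rw [h1, h2, hπ.campbellLaw_eq_of_nonneg ψ hψ]

/-- The Mecke identity in integral form. -/
theorem IsPoissonMeasure.lintegral_mecke (hπ : IsPoissonMeasure m π) (φ : ι → C_c(Y, ℝ))
    {Φ : (ι → ℝ) × Y → ℝ≥0∞} (hΦ : Measurable Φ) :
    ∫⁻ γ, ∫⁻ y, Φ (fun i => γ.pairing (φ i), y) ∂countMeasure γ ∂π =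
      ∫⁻ γ, ∫⁻ y, Φ (fun i => γ.pairing (φ i) + φ i y, y) ∂m ∂π := by
  have := hπ.isProbabilityMeasure
  rw [← lintegral_campbellLaw φ hΦ, ← lintegral_birthLaw φ hΦ, hπ.campbellLaw_eq]

/-- The intensity measure is the mean of the counting measures. -/
theorem IsPoissonMeasure.lintegral_lintegral (hπ : IsPoissonMeasure m π) {f : Y → ℝ≥0∞}
    (hf : Measurable f) : ∫⁻ γ, ∫⁻ y, f y ∂countMeasure γ ∂π = ∫⁻ y, f y ∂m := by
  have := hπ.isProbabilityMeasure
  have h := hπ.lintegral_mecke (ι := Empty) (fun i => i.elim) (Φ := fun p => f p.2)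
    (hf.comp measurable_snd)
  simpa using h

/-- The second moments of a Poisson measure. -/
theorem IsPoissonMeasure.lintegral_mul (hπ : IsPoissonMeasure m π) {f g : C_c(Y, ℝ)}
    (hf : ∀ y, 0 ≤ f y) (hg : ∀ y, 0 ≤ g y) :
    ∫⁻ γ, ENNReal.ofReal (γ.pairing f) * ENNReal.ofReal (γ.pairing g) ∂π =
      (∫⁻ y, ENNReal.ofReal (f y) ∂m) * (∫⁻ y, ENNReal.ofReal (g y) ∂m) +
        ∫⁻ y, ENNReal.ofReal (f y) * ENNReal.ofReal (g y) ∂m := by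
  have := hπ.isProbabilityMeasure
  have h := hπ.lintegral_mecke (ι := Unit) (fun _ => g)
    (Φ := fun p => ENNReal.ofReal (f p.2) * ENNReal.ofReal (p.1 ()))
    (((measurable_ofReal_coe f).comp measurable_snd).mul (by fun_prop))
  have h1 : ∀ γ : Configuration Y,
      ∫⁻ y, ENNReal.ofReal (f y) * ENNReal.ofReal (γ.pairing g) ∂countMeasure γ =
        ENNReal.ofReal (γ.pairing f) * ENNReal.ofReal (γ.pairing g) := fun γ => by
    rw [lintegral_mul_const _ (measurable_ofReal_coe f), lintegral_countMeasure_coe γ hf]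
  have h2 : ∀ γ : Configuration Y,
      ∫⁻ y, ENNReal.ofReal (f y) * ENNReal.ofReal (γ.pairing g + g y) ∂m =
        (∫⁻ y, ENNReal.ofReal (f y) ∂m) * ENNReal.ofReal (γ.pairing g) +
        ∫⁻ y, ENNReal.ofReal (f y) * ENNReal.ofReal (g y) ∂m := fun γ => by
    rw [← lintegral_mul_const _ (measurable_ofReal_coe f),
      ← lintegral_add_left ((measurable_ofReal_coe f).mul_const _)]
    refine lintegral_congr fun y => ?_
    rw [ENNReal.ofReal_add (pairing_nonneg γ hg) (hg y), mul_add]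
  simp_rw [h1, h2] at h
  rw [h, lintegral_add_right _ measurable_const, lintegral_const_mul _
    (measurable_pairing g).ennreal_ofReal]
  simp_rw [← lintegral_countMeasure_coe _ hg]
  rw [hπ.lintegral_lintegral (measurable_ofReal_coe g)]
  simp

/-- Off the diagonal, the second moment measure of a Poisson measure is `m ⊗ m`. -/
theorem IsPoissonMeasure.bind_prod (hπ : IsPoissonMeasure m π) :
    π.bind (countKernel Y ×ₖ countKernel Y) = m.prod m + m.map fun y => (y, y) := by
  have := hπ.isProbabilityMeasure
  have hd : Measurable fun y : Y => (y, y) := by fun_prop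
  have hfin : IsFiniteMeasureOnCompacts (m.prod m + m.map fun y => (y, y)) := ⟨fun K hK => by
    have h1 : IsCompact (Prod.fst '' K) := hK.image continuous_fst
    have h2 : IsCompact (Prod.snd '' K) := hK.image continuous_snd
    rw [Measure.add_apply, Measure.map_apply hd hK.measurableSet]
    refine ENNReal.add_lt_top.2 ⟨?_, ?_⟩
    · refine (measure_mono (t := (Prod.fst '' K) ×ˢ (Prod.snd '' K)) fun p hp =>
        ⟨⟨p, hp, rfl⟩, ⟨p, hp, rfl⟩⟩).trans_lt ?_
      rw [Measure.prod_prod]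
      exact ENNReal.mul_lt_top h1.measure_lt_top h2.measure_lt_top
    · exact (measure_mono (t := Prod.fst '' K) fun y hy => ⟨_, hy, rfl⟩).trans_lt
        h1.measure_lt_top⟩
  symm
  refine measure_prod_ext fun f g hf hg => ?_
  have hm : Measurable fun p : Y × Y => ENNReal.ofReal (f p.1) * ENNReal.ofReal (g p.2) :=
    ((measurable_ofReal_coe f).comp measurable_fst).mul
      ((measurable_ofReal_coe g).comp measurable_snd)
  rw [lintegral_add_measure, lintegral_map hm hd, lintegral_prod_mul
    (measurable_ofReal_coe f).aemeasurable (measurable_ofReal_coe g).aemeasurable,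
    Measure.lintegral_bind (Kernel.aemeasurable _) hm.aemeasurable, ← hπ.lintegral_mul hf hg]
  refine lintegral_congr fun γ => ?_
  rw [Kernel.lintegral_prod _ _ _ hm]
  simp_rw [countKernel_apply]
  rw [← lintegral_countMeasure_coe γ hf, ← lintegral_countMeasure_coe γ hg,
    ← lintegral_mul_const _ (measurable_ofReal_coe f)]
  exact lintegral_congr fun y => (lintegral_const_mul _ (measurable_ofReal_coe g)).symm

/-- If two independent points with intensity `m` almost never have the same image under `q`, then
almost surely `q` is injective on a Poisson configuration. -/
theorem IsPoissonMeasure.ae_injOn (hπ : IsPoissonMeasure m π) {X : Type*} {q : Y → X}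
    (hq : MeasurableSet {p : Y × Y | q p.1 = q p.2}) (h0 : m.prod m {p | q p.1 = q p.2} = 0) :
    ∀ᵐ γ ∂π, InjOn q γ.carrier := by
  have := hπ.isProbabilityMeasure
  let D : Set (Y × Y) := {p | q p.1 = q p.2} \ {p | p.1 = p.2}
  have hD : MeasurableSet D := hq.diff (isClosed_eq continuous_fst continuous_snd).measurableSet
  have hD0 : π.bind (countKernel Y ×ₖ countKernel Y) D = 0 := by
    have h1 : m.prod m D = 0 := measure_mono_null sdiff_subset h0
    have h2 : (fun y : Y => (y, y)) ⁻¹' D = ∅ := by ext y; simp [D]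
    rw [hπ.bind_prod, Measure.add_apply, Measure.map_apply (by fun_prop) hD, h1, h2]
    simp
  rw [Measure.bind_apply hD (Kernel.aemeasurable _),
    lintegral_eq_zero_iff (Kernel.measurable_coe _ hD)] at hD0
  filter_upwards [hD0] with γ hγ y hy y' hy' hyy'
  by_contra hne
  have hpos : ∀ z ∈ γ.carrier, 1 ≤ countMeasure γ {z} := fun z hz => by
    rw [countMeasure]
    refine le_trans ?_ (Measure.le_sum_apply _ _)
    exact (by simp : (1 : ℝ≥0∞) ≤ Measure.dirac z {z}).trans
      (ENNReal.le_tsum (f := fun y : γ.carrier => Measure.dirac (y : Y) {z}) ⟨z, hz⟩)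
  have hle : ({y} : Set Y) ×ˢ {y'} ⊆ D := by
    rintro ⟨a, b⟩ ⟨ha, hb⟩
    obtain rfl : a = y := ha
    obtain rfl : b = y' := hb
    exact ⟨hyy', hne⟩
  have h3 := measure_mono_null hle hγ
  rw [Kernel.prod_apply, Measure.prod_prod, countKernel_apply] at h3
  rcases mul_eq_zero.1 h3 with h | h
  · have := hpos y hy
    simp [h] at this
  · have := hpos y' hy'
    simp [h] at this

end MeckeIdentity

/-! ### The law of the atoms of a random cone element -/

section ConeLaw

/-- A measure carried by a set `s` is the image of its trace on `s`. -/
theorem map_comap_subtype {α : Type*} [MeasurableSpace α] {P : Measure α} {s : Set α}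
    (hs : ∀ᵐ a ∂P, a ∈ s) : (P.comap (Subtype.val : s → α)).map Subtype.val = P := by
  have hn : NullMeasurableSet s P := by
    rw [← NullMeasurableSet.compl_iff]
    exact NullMeasurableSet.of_null hs
  refine Measure.ext fun t ht => ?_
  rw [Measure.map_apply measurable_subtype_coe ht, Measure.comap_apply₀ _ _ Subtype.coe_injective
    (fun h => Measure.MeasurableSet.nullMeasurableSet_subtype_coe hn)
    (measurable_subtype_coe ht).nullMeasurableSet, image_preimage_eq_inter_range,
    Subtype.range_coe]
  exact measure_inter_conull hs

open ProbabilityTheory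

variable {X : Type*} [TopologicalSpace X] [T2Space X] [SecondCountableTopology X]
  [LocallyCompactSpace X] [MeasurableSpace X] [BorelSpace X]

omit [LocallyCompactSpace X] in
theorem lintegral_markedSum (γ : Configuration (Marked X)) (u : X → ℝ≥0∞) :
    ∫⁻ x, u x ∂markedSum γ.carrier =
      ∫⁻ p, ENNReal.ofReal p.1 * u p.2 ∂countMeasure γ := by
  rw [markedSum, lintegral_sum_measure, lintegral_countMeasure]
  simp

theorem ae_countMeasure {γ : Configuration (Marked X)} {P : Marked X → Prop}
    (h : ∀ p ∈ γ.carrier, P p) : ∀ᵐ p ∂countMeasure γ, P p := by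
  have := γ.countable.to_subtype
  rw [countMeasure, Measure.ae_sum_iff]
  intro p
  rw [ae_dirac_eq]
  exact h p p.2

theorem integrable_markedSum {γ : Configuration (Marked X)} {u : X → ℝ}
    (hu : Integrable (fun p : Marked X => (p.1 : ℝ) * u p.2) (countMeasure γ)) :
    Integrable u (markedSum γ.carrier) := by
  have := γ.countable.to_subtype
  refine ⟨aestronglyMeasurable_sum_measure_iff.2 fun p =>
    (aestronglyMeasurable_dirac.smul_measure _), ?_⟩
  have h := hu.2
  rw [hasFiniteIntegral_iff_enorm] at h ⊢
  rw [lintegral_markedSum]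
  refine lt_of_eq_of_lt (lintegral_congr fun p => ?_) h
  rw [enorm_mul, Real.enorm_of_nonneg (le_of_lt p.1.2)]

theorem integral_markedSum {γ : Configuration (Marked X)} {u : X → ℝ}
    (hu : Integrable (fun p : Marked X => (p.1 : ℝ) * u p.2) (countMeasure γ)) :
    ∫ x, u x ∂markedSum γ.carrier = ∫ p, (p.1 : ℝ) * u p.2 ∂countMeasure γ := by
  have h := integrable_markedSum hu
  rw [integral_countMeasure hu]
  rw [markedSum] at h ⊢
  rw [integral_sum_measure h]
  refine tsum_congr fun p => ?_
  rw [integral_smul_measure, integral_dirac, ENNReal.toReal_ofReal (le_of_lt p.1.1.2), smul_eq_mul]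

instance (η : Cone X) : IsFiniteMeasureOnCompacts η.toMeasure :=
  ⟨fun K hK => η.finite_of_isCompact K hK⟩

theorem integrable_of_markedSum (η : Cone X) {u : X → ℝ} (hu : Integrable u η.toMeasure) :
    Integrable (fun p : Marked X => (p.1 : ℝ) * u p.2) (countMeasure η.atoms) := by
  have := η.atoms.countable.to_subtype
  refine ⟨aestronglyMeasurable_sum_measure_iff.2 fun p => aestronglyMeasurable_dirac, ?_⟩
  have h := hu.2
  rw [hasFiniteIntegral_iff_enorm] at h ⊢
  have h2 := lintegral_markedSum η.atoms fun x => ‖u x‖ₑ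
  rw [show markedSum η.atoms.carrier = η.toMeasure from η.markedSum_atomSet] at h2
  rw [h2] at h
  refine lt_of_eq_of_lt (lintegral_congr fun p => ?_) h
  rw [enorm_mul, Real.enorm_of_nonneg (le_of_lt p.1.2)]

/-- A cone element integrates as its atoms, weighted by their masses. -/
theorem integral_cone (η : Cone X) {u : X → ℝ} (hu : Integrable u η.toMeasure) :
    ∫ x, u x ∂η.toMeasure = ∫ p, (p.1 : ℝ) * u p.2 ∂countMeasure η.atoms := by
  have h := integral_markedSum (integrable_of_markedSum η hu)
  rwa [show markedSum η.atoms.carrier = η.toMeasure from η.markedSum_atomSet] at h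

/-- A map into the cone is measurable if the integrals of all `f ∈ C_c` are. -/
theorem measurable_cone {Ω : Type*} [MeasurableSpace Ω] {T : Ω → Cone X}
    (h : ∀ f : C_c(X, ℝ), Measurable fun ω => ∫ x, f x ∂(T ω).toMeasure) : Measurable T :=
  measurable_of_measurable_integral (M := Cone.toMeasure) rfl h

omit [T2Space X] [SecondCountableTopology X] [LocallyCompactSpace X] [BorelSpace X] in
theorem measurable_integral_cone (f : C_c(X, ℝ)) :
    Measurable fun η : Cone X => ∫ x, f x ∂η.toMeasure := by
  have : Continuous fun (η : Cone X) (f : C_c(X, ℝ)) => ∫ x, f x ∂η.toMeasure :=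
    continuous_induced_dom
  exact ((continuous_apply f).comp this).measurable

/-- The elements of the cone as a kernel. -/
def coneKernel (X : Type*) [TopologicalSpace X] [T2Space X] [SecondCountableTopology X]
    [LocallyCompactSpace X] [MeasurableSpace X] [BorelSpace X] : Kernel (Cone X) X where
  toFun := Cone.toMeasure
  measurable' := measurable_measure_of_lintegral fun f hf => by
    simp_rw [← ofReal_integral_eq_lintegral_ofReal (integrable_coe f _) (Eventually.of_forall hf)]
    exact (measurable_integral_cone f).ennreal_ofReal

theorem coneKernel_apply (η : Cone X) : coneKernel X η = η.toMeasure := rfl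

instance : IsSFiniteKernel (coneKernel X) :=
  have : ∀ η, IsFiniteMeasureOnCompacts (coneKernel X η) := fun η =>
    inferInstanceAs (IsFiniteMeasureOnCompacts η.toMeasure)
  isSFiniteKernel_of_isFiniteMeasureOnCompacts _

/-- The mass `s_x` of the atom at `x` depends measurably on `(η, x)`, because the diagonal of `X`
is measurable. -/
theorem measurable_mass : Measurable fun p : Cone X × X => p.1.toMeasure {p.2} := by
  have ht : MeasurableSet {q : (Cone X × X) × X | q.2 = q.1.2} :=
    (measurable_snd.prodMk (measurable_snd.comp measurable_fst))
      (isClosed_diagonal (X := X)).measurableSet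
  exact Kernel.measurable_kernel_prodMk_left (κ := (coneKernel X).prodMkRight X) ht

/-- The configuration of the atoms of a cone element depends measurably on it. -/
theorem measurable_atoms : Measurable (Cone.atoms : Cone X → Configuration (Marked X)) := by
  refine measurable_configuration fun φ => ?_
  have he : MeasurableEmbedding fun p : Marked X => ((p.1 : ℝ), p.2) :=
    (MeasurableEmbedding.subtype_coe measurableSet_Ioi).prodMap .id
  obtain ⟨Θ, hΘ, hΘφ⟩ : ∃ Θ : ℝ × X → ℝ, Measurable Θ ∧ ∀ p : Marked X, Θ (p.1, p.2) = φ p / p.1 :=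
    ⟨_, he.measurable_extend (φ.continuous.measurable.div
      (measurable_subtype_coe.comp measurable_fst)) (measurable_const (a := (0 : ℝ))),
      fun p => he.injective.extend_apply _ _ p⟩
  have hu : Measurable fun q : Cone X × X => Θ ((q.1.toMeasure {q.2}).toReal, q.2) :=
    hΘ.comp (measurable_mass.ennreal_toReal.prodMk measurable_snd)
  -- on the atoms `(s, x)` of `η` the mass `η {x}` is `s`, and `φ(s, x) = s Θ(s, x)`
  have key : ∀ η : Cone X, η.atoms.pairing φ =
      ∫ x, Θ ((η.toMeasure {x}).toReal, x) ∂coneKernel X η := by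
    intro η
    have hp : ∀ᵐ p ∂countMeasure η.atoms,
        (p.1 : ℝ) * Θ ((η.toMeasure {p.2}).toReal, p.2) = φ p := by
      refine ae_countMeasure fun p hp => ?_
      have h1 : η.toMeasure {p.2} = ENNReal.ofReal p.1 := hp
      rw [h1, ENNReal.toReal_ofReal (le_of_lt p.1.2), hΘφ]
      have : (p.1 : ℝ) ≠ 0 := ne_of_gt p.1.2
      field_simp
    have h := integral_markedSum (u := fun x => Θ ((η.toMeasure {x}).toReal, x))
      ((integrable_congr hp).2 (integrable_coe φ _))
    rw [show markedSum η.atoms.carrier = η.toMeasure from η.markedSum_atomSet] at h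
    rw [coneKernel_apply, h, integral_congr_ae hp, integral_countMeasure_coe]
  simp_rw [key]
  exact (hu.stronglyMeasurable.integral_kernel_prod_right' (κ := coneKernel X)).measurable

theorem measurable_integral_marked (f : C_c(X, ℝ)) :
    Measurable fun γ : Configuration (Marked X) =>
      ∫ p, (p.1 : ℝ) * f p.2 ∂countMeasure γ := by
  have hf : Measurable fun p : Marked X => (p.1 : ℝ) * f p.2 :=
    (measurable_subtype_coe.comp measurable_fst).mul (f.continuous.measurable.comp measurable_snd)
  exact (hf.stronglyMeasurable.integral_kernel (κ := countKernel (Marked X))).measurable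

theorem measurable_bijR : Measurable (bijR : pinpointing X → Cone X) := by
  refine measurable_cone fun f => ?_
  have : ∀ γ : pinpointing X, ∫ x, f x ∂(bijR γ).toMeasure =
      ∫ p, (p.1 : ℝ) * f p.2 ∂countMeasure γ.1 := fun γ => by
    have h := integral_cone (bijR γ) (integrable_coe f _)
    rwa [show (bijR γ).atoms = γ.1 from congrArg Subtype.val (bijR.symm_apply_apply γ)] at h
  simp_rw [this]
  exact (measurable_integral_marked f).comp measurable_subtype_coe

/-- The Borel `σ`-algebra of the cone is generated by the functionals `⟨ℛ⁻¹η, φ⟩`. -/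
theorem measurableSpace_cone_le_comap :
    (inferInstance : MeasurableSpace (Cone X)) ≤ MeasurableSpace.comap
      (fun (η : Cone X) (φ : C_c(Marked X, ℝ)) => η.atoms.pairing φ) inferInstance := by
  set mc : MeasurableSpace (Cone X) := MeasurableSpace.comap
    (fun (η : Cone X) (φ : C_c(Marked X, ℝ)) => η.atoms.pairing φ) inferInstance with hmc
  have h1 : @Measurable _ _ mc _ (Cone.atoms : Cone X → Configuration (Marked X)) := by
    refine @measurable_configuration _ _ _ _ _ _ _ _ mc _ fun φ => ?_
    exact (measurable_pi_apply (X := fun _ : C_c(Marked X, ℝ) => ℝ) φ).comp (comap_measurable _)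
  have h2 : @Measurable _ _ mc instMeasurableSpaceCone (id : Cone X → Cone X) := by
    refine @measurable_cone _ _ _ _ _ _ _ _ mc _ fun f => ?_
    have : ∀ η : Cone X, ∫ x, f x ∂η.toMeasure = ∫ p, (p.1 : ℝ) * f p.2 ∂countMeasure η.atoms :=
      fun η => integral_cone η (integrable_coe f _)
    simp only [id, this]
    exact (measurable_integral_marked f).comp h1
  exact fun s hs => h2 hs

variable {ν : Measure (Ioi (0 : ℝ))} [IsLocallyFiniteMeasure ν] {σ : Measure X}
  [IsLocallyFiniteMeasure σ] [NullSingletonClass σ] {π : Measure (Configuration (Marked X))}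

/-- Almost every Poisson configuration has at most one point over each `x` (as `σ` is non-atomic)
and finite local mass (as its mean is finite). -/
theorem IsPoissonMeasure.ae_mem_pinpointing (hπ : IsPoissonMeasure (ν.prod σ) π)
    (hν : ∫⁻ s, ENNReal.ofReal (s : ℝ) ∂ν < ∞) : ∀ᵐ γ ∂π, γ ∈ pinpointing X := by
  have hq : MeasurableSet {p : Marked X × Marked X | p.1.2 = p.2.2} :=
    (isClosed_eq (by fun_prop) (by fun_prop)).measurableSet
  have h0 : (ν.prod σ).prod (ν.prod σ) {p | p.1.2 = p.2.2} = 0 := by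
    rw [Measure.measure_prod_null hq]
    refine Eventually.of_forall fun p => ?_
    have : Prod.mk p ⁻¹' {p : Marked X × Marked X | p.1.2 = p.2.2} = univ ×ˢ {p.2} := by
      ext p'
      simp [eq_comm]
    change (ν.prod σ) (Prod.mk p ⁻¹' {p : Marked X × Marked X | p.1.2 = p.2.2}) = 0
    rw [this, Measure.prod_prod, measure_singleton, mul_zero]
  have hmass : ∀ γ : Configuration (Marked X), ∀ Λ : Set X, localMass γ.carrier Λ =
      ∫⁻ p, Λ.indicator (fun _ => ENNReal.ofReal p.1) p.2 ∂countMeasure γ := fun γ Λ => by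
    rw [lintegral_countMeasure]
    rfl
  let E : CompactExhaustion X := CompactExhaustion.choice X
  have hfin : ∀ n, ∀ᵐ γ ∂π, localMass γ.carrier (E n) < ∞ := by
    intro n
    have hm : Measurable fun p : Marked X =>
        (E n).indicator (fun _ => ENNReal.ofReal p.1) p.2 := by
      have : MeasurableSet {p : Marked X | p.2 ∈ E n} :=
        measurable_snd (E.isCompact n).measurableSet
      exact Measurable.indicator
        (f := fun p : Marked X => ENNReal.ofReal p.1) (by fun_prop) this
    refine ae_lt_top' ?_ ?_
    · simp_rw [hmass]
      exact (hm.lintegral_kernel (κ := countKernel (Marked X))).aemeasurable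
    · simp_rw [hmass]
      rw [hπ.lintegral_lintegral hm]
      have hprod : ∀ p : Marked X, (E n).indicator (fun _ => ENNReal.ofReal p.1) p.2
          = ENNReal.ofReal p.1 * (E n).indicator 1 p.2 := fun p => by
        by_cases hp : p.2 ∈ E n <;> simp [hp]
      simp_rw [hprod]
      rw [lintegral_prod_mul (f := fun s : Ioi (0 : ℝ) => ENNReal.ofReal s) (by fun_prop)
        (measurable_one.indicator (E.isCompact n).measurableSet).aemeasurable,
        lintegral_indicator_one (E.isCompact n).measurableSet]
      exact (ENNReal.mul_lt_top hν (E.isCompact n).measure_lt_top).ne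
  filter_upwards [hπ.ae_injOn hq h0, ae_all_iff.2 hfin] with γ h1 h2
  refine ⟨fun p hp q hq h => congrArg Prod.fst (h1 hp hq h), fun Λ hΛ hc => ?_⟩
  obtain ⟨n, hn⟩ := E.exists_superset_of_isCompact hc
  refine lt_of_le_of_lt ?_ (h2 n)
  exact ENNReal.tsum_le_tsum fun p =>
    indicator_le_indicator_of_subset (subset_closure.trans hn) (fun _ => zero_le) _

/-- The atoms of a random cone element with law `π_{𝕂,ν⊗σ}` form a Poisson configuration. -/
theorem IsPoissonMeasure.measurePreserving_atoms (hπ : IsPoissonMeasure (ν.prod σ) π)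
    (hν : ∫⁻ s, ENNReal.ofReal (s : ℝ) ∂ν < ∞) :
    MeasurePreserving Cone.atoms (coneMeasure π) π := by
  refine ⟨measurable_atoms, ?_⟩
  rw [coneMeasure, Measure.map_map measurable_atoms measurable_bijR]
  have : Cone.atoms ∘ bijR = (Subtype.val : pinpointing X → Configuration (Marked X)) :=
    funext fun γ => congrArg Subtype.val (bijR.symm_apply_apply γ)
  rw [this, map_comap_subtype (hπ.ae_mem_pinpointing hν)]

end ConeLaw

/-! ### Functionals of a configuration and one of its points -/

section Dominated

open ProbabilityTheory

variable {Y : Type*} [TopologicalSpace Y] [T2Space Y] [LocallyCompactSpace Y]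
  [SecondCountableTopology Y] [MeasurableSpace Y] [BorelSpace Y] {m : Measure Y}
  [IsLocallyFiniteMeasure m] {π : Measure (Configuration Y)} {ι : Type*} [Fintype ι]

/-- The vector `(⟨γ, φ_i⟩)_i`. -/
def pairingVec (φ : ι → C_c(Y, ℝ)) (γ : Configuration Y) : ι → ℝ := fun i => γ.pairing (φ i)

omit [T2Space Y] [LocallyCompactSpace Y] [SecondCountableTopology Y] [MeasurableSpace Y]
  [BorelSpace Y] [Fintype ι] in
theorem measurable_pairingVec (φ : ι → C_c(Y, ℝ)) : Measurable (pairingVec φ) :=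
  measurable_pi_lambda _ fun i => measurable_pairing (φ i)

/-- A continuous function of `(v, y)` that is dominated, uniformly in `v`, by a compactly supported
function of `y`. -/
def IsDominated (Φ : (ι → ℝ) × Y → ℝ) : Prop :=
  Continuous Φ ∧ ∃ ω : C_c(Y, ℝ), ∀ q, |Φ q| ≤ ω q.2

namespace IsDominated

variable {Φ Ψ : (ι → ℝ) × Y → ℝ}

omit [T2Space Y] [LocallyCompactSpace Y] [SecondCountableTopology Y] [MeasurableSpace Y]
  [BorelSpace Y] [Fintype ι] in
theorem mul_bounded (hΦ : IsDominated Φ) {B : (ι → ℝ) × Y → ℝ} (hB : Continuous B) {C : ℝ}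
    (hC : ∀ q, |B q| ≤ C) : IsDominated fun q => Φ q * B q := by
  obtain ⟨hc, ω, hω⟩ := hΦ
  refine ⟨hc.mul hB, C • ω, fun q => ?_⟩
  rw [abs_mul, CompactlySupportedContinuousMap.smul_apply, smul_eq_mul, mul_comm]
  exact mul_le_mul (hC q) (hω q) (abs_nonneg _) ((abs_nonneg _).trans (hC q))

omit [LocallyCompactSpace Y] [SecondCountableTopology Y] [Fintype ι] in
theorem integrable_right (hΦ : IsDominated Φ) (v : ι → ℝ) (μ : Measure Y)
    [IsFiniteMeasureOnCompacts μ] : Integrable (fun y => Φ (v, y)) μ := by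
  obtain ⟨hc, ω, hω⟩ := hΦ
  refine Continuous.integrable_of_hasCompactSupport (by fun_prop) ?_
  refine HasCompactSupport.intro ω.hasCompactSupport fun y hy => ?_
  have := hω (v, y)
  rw [image_eq_zero_of_notMem_tsupport hy] at this
  exact abs_nonpos_iff.1 this

omit [T2Space Y] [LocallyCompactSpace Y] in
theorem stronglyMeasurable (hΦ : IsDominated Φ) : StronglyMeasurable Φ :=
  hΦ.1.measurable.stronglyMeasurable

theorem measurable_integral_count (hΦ : IsDominated Φ) (φ : ι → C_c(Y, ℝ)) :
    Measurable fun γ => ∫ y, Φ (pairingVec φ γ, y) ∂countMeasure γ :=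
  ((hΦ.stronglyMeasurable.comp_measurable (measurable_pairing_prod φ)).integral_kernel_prod_right'
    (κ := countKernel Y)).measurable

omit [T2Space Y] [LocallyCompactSpace Y] in
theorem measurable_integral_intensity (hΦ : IsDominated Φ) (φ : ι → C_c(Y, ℝ)) :
    Measurable fun γ => ∫ y, Φ (pairingVec φ γ, y) ∂m :=
  (hΦ.stronglyMeasurable.comp_measurable
    (measurable_pairing_prod φ)).integral_prod_right'.measurable

omit [LocallyCompactSpace Y] [SecondCountableTopology Y] [Fintype ι] in
theorem abs_integral_le (hΦ : IsDominated Φ) : ∃ ω : C_c(Y, ℝ), (∀ y, 0 ≤ ω y) ∧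
    ∀ (v : ι → ℝ) (μ : Measure Y) [IsFiniteMeasureOnCompacts μ],
      |∫ y, Φ (v, y) ∂μ| ≤ ∫ y, ω y ∂μ := by
  obtain ⟨ω, hω⟩ := hΦ.2
  refine ⟨ω, fun y => (abs_nonneg _).trans (hω (0, y)), fun v μ _ => ?_⟩
  exact abs_integral_le_integral_abs.trans
    (integral_mono (hΦ.integrable_right v μ).abs (integrable_coe ω μ) fun y => hω (v, y))

/-- The sum over the points of a Poisson configuration is square integrable. -/
theorem memLp_count (hΦ : IsDominated Φ) (hπ : IsPoissonMeasure m π) (φ : ι → C_c(Y, ℝ)) :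
    MemLp (fun γ => ∫ y, Φ (pairingVec φ γ, y) ∂countMeasure γ) 2 π := by
  obtain ⟨ω, hω0, hω⟩ := hΦ.abs_integral_le
  have h2 : MemLp (fun γ : Configuration Y => γ.pairing ω) 2 π := by
    refine (memLp_two_iff_integrable_sq (measurable_pairing ω).aestronglyMeasurable).2 ?_
    refine ⟨((measurable_pairing ω).pow_const 2).aestronglyMeasurable, ?_⟩
    rw [hasFiniteIntegral_iff_ofReal (Eventually.of_forall fun γ => sq_nonneg _)]
    simp_rw [sq]
    simp_rw [ENNReal.ofReal_mul (pairing_nonneg _ hω0)]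
    rw [hπ.lintegral_mul hω0 hω0]
    have h1 : ∫⁻ y, ENNReal.ofReal (ω y) ∂m < ∞ := (integrable_coe ω m).lintegral_lt_top
    refine ENNReal.add_lt_top.2 ⟨ENNReal.mul_lt_top h1 h1, ?_⟩
    simp_rw [← ENNReal.ofReal_mul (hω0 _)]
    exact (integrable_coe (ω * ω) m).lintegral_lt_top
  refine h2.mono (hΦ.measurable_integral_count φ).aestronglyMeasurable
    (Eventually.of_forall fun γ => ?_)
  rw [Real.norm_eq_abs, Real.norm_eq_abs]
  refine (hω _ _).trans ?_
  rw [integral_countMeasure_coe]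
  exact le_abs_self _

theorem memLp_intensity (hΦ : IsDominated Φ) (hπ : IsPoissonMeasure m π) (φ : ι → C_c(Y, ℝ)) :
    MemLp (fun γ => ∫ y, Φ (pairingVec φ γ, y) ∂m) 2 π := by
  have := hπ.isProbabilityMeasure
  obtain ⟨ω, -, hω⟩ := hΦ.abs_integral_le
  exact MemLp.of_bound (hΦ.measurable_integral_intensity φ).aestronglyMeasurable (∫ y, ω y ∂m)
    (Eventually.of_forall fun γ => hω _ _)

theorem integrable_campbellLaw (hΦ : IsDominated Φ) (hπ : IsPoissonMeasure m π)
    (φ : ι → C_c(Y, ℝ)) : Integrable Φ (campbellLaw π φ) := by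
  have := hπ.isProbabilityMeasure
  obtain ⟨hc, ω, hω⟩ := hΦ
  refine ⟨hc.measurable.aestronglyMeasurable, ?_⟩
  rw [hasFiniteIntegral_iff_norm]
  have hm : Measurable fun q : (ι → ℝ) × Y => ENNReal.ofReal (ω q.2) :=
    (measurable_ofReal_coe ω).comp measurable_snd
  refine (lintegral_mono fun q => ENNReal.ofReal_le_ofReal (hω q)).trans_lt ?_
  rw [lintegral_campbellLaw φ hm, hπ.lintegral_lintegral (measurable_ofReal_coe ω)]
  exact (integrable_coe ω m).lintegral_lt_top

/-- The Mecke identity for dominated functionals. -/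
theorem integral_mecke (hΦ : IsDominated Φ) (hπ : IsPoissonMeasure m π) (φ : ι → C_c(Y, ℝ)) :
    ∫ γ, ∫ y, Φ (pairingVec φ γ, y) ∂countMeasure γ ∂π =
      ∫ γ, ∫ y, Φ (fun i => pairingVec φ γ i + φ i y, y) ∂m ∂π := by
  have := hπ.isProbabilityMeasure
  have hi := hΦ.integrable_campbellLaw hπ φ
  have h1 : ∫ q, Φ q ∂campbellLaw π φ =
      ∫ γ, ∫ y, Φ (pairingVec φ γ, y) ∂countMeasure γ ∂π := by
    rw [campbellLaw] at hi ⊢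
    rw [integral_map (measurable_pairing_prod φ).aemeasurable hi.1]
    exact Measure.integral_compProd
      ((integrable_map_measure hi.1 (measurable_pairing_prod φ).aemeasurable).1 hi)
  rw [hπ.campbellLaw_eq] at hi
  have h2 : ∫ q, Φ q ∂birthLaw m π φ =
      ∫ γ, ∫ y, Φ (fun i => pairingVec φ γ i + φ i y, y) ∂m ∂π := by
    rw [birthLaw] at hi ⊢
    rw [integral_map (measurable_pairing_add_prod φ).aemeasurable hi.1]
    exact integral_prod _
      ((integrable_map_measure hi.1 (measurable_pairing_add_prod φ).aemeasurable).1 hi)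
  rw [← h1, ← h2, hπ.campbellLaw_eq]

end IsDominated

end Dominated

/-! ### Cylinder functions -/

section Cylinder

variable {X : Type*} [TopologicalSpace X] [T2Space X] [SecondCountableTopology X]
  [LocallyCompactSpace X] [MeasurableSpace X] [BorelSpace X] {ι : Type*} [Fintype ι]

/-- The cylinder function `η ↦ g(⟨ℛ⁻¹η, φ⟩)`. -/
def cyl (φ : ι → C_c(Marked X, ℝ)) (g : (ι → ℝ) →ᵇ ℝ) (η : Cone X) : ℝ :=
  g (pairingVec φ η.atoms)

/-- The mass-weighted increment `s (g(v - φ(s, x)) - g(v))` for the removal of the atom `(s, x)`. -/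
def deathIncr (φ : ι → C_c(Marked X, ℝ)) (g : (ι → ℝ) →ᵇ ℝ) (q : (ι → ℝ) × Marked X) : ℝ :=
  (q.2.1 : ℝ) * (g (fun i => q.1 i - φ i q.2) - g q.1)

/-- The mass-weighted increment `s (g(v + φ(s, x)) - g(v))` for the creation of an atom `(s, x)`. -/
def birthIncr (φ : ι → C_c(Marked X, ℝ)) (g : (ι → ℝ) →ᵇ ℝ) (q : (ι → ℝ) × Marked X) : ℝ :=
  (q.2.1 : ℝ) * (g (fun i => q.1 i + φ i q.2) - g q.1)

theorem cyl_mem_cylinder (φ : ι → C_c(Marked X, ℝ)) (g : (ι → ℝ) →ᵇ ℝ) :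
    cyl φ g ∈ cylinder X := by
  let e := Fintype.equivFin ι
  refine ⟨Fintype.card ι, g.compContinuous ⟨fun w i => w (e i), by fun_prop⟩, fun i => φ (e.symm i),
    fun η => ?_⟩
  simp only [BoundedContinuousFunction.compContinuous_apply, ContinuousMap.coe_mk,
    e.symm_apply_apply]
  rfl

theorem mem_cylinder_iff {F : Cone X → ℝ} : F ∈ cylinder X ↔
    ∃ (N : ℕ) (φ : Fin N → C_c(Marked X, ℝ)) (g : (Fin N → ℝ) →ᵇ ℝ), F = cyl φ g := by
  constructor
  · rintro ⟨N, g, φ, h⟩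
    exact ⟨N, φ, g, funext h⟩
  · rintro ⟨N, φ, g, rfl⟩
    exact cyl_mem_cylinder φ g

/-- Two cylinder functions can be based on the same functionals. -/
theorem exists_common_cyl {F G : Cone X → ℝ} (hF : F ∈ cylinder X) (hG : G ∈ cylinder X) :
    ∃ (N : ℕ) (φ : Fin N → C_c(Marked X, ℝ)) (g h : (Fin N → ℝ) →ᵇ ℝ),
      F = cyl φ g ∧ G = cyl φ h := by
  obtain ⟨N, φ, g, rfl⟩ := mem_cylinder_iff.1 hF
  obtain ⟨M, ψ, h, rfl⟩ := mem_cylinder_iff.1 hG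
  refine ⟨N + M, Fin.append φ ψ,
    g.compContinuous ⟨fun w i => w (Fin.castAdd M i), by fun_prop⟩,
    h.compContinuous ⟨fun w i => w (Fin.natAdd N i), by fun_prop⟩, ?_, ?_⟩ <;>
  · funext η
    simp only [cyl, BoundedContinuousFunction.compContinuous_apply, ContinuousMap.coe_mk]
    congr 1
    funext i
    simp [pairingVec]

omit [SecondCountableTopology X] [MeasurableSpace X] [BorelSpace X] in
/-- On the support of the increments the mass `s` is dominated by a function in `C_c`. -/
theorem exists_mass_bound (φ : ι → C_c(Marked X, ℝ)) :
    ∃ ω : C_c(Marked X, ℝ), (∀ p, 0 ≤ ω p) ∧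
      ∀ p : Marked X, (∃ i, φ i p ≠ 0) → (p.1 : ℝ) ≤ ω p := by
  have hK : IsCompact (⋃ i, tsupport (φ i)) := isCompact_iUnion fun i => (φ i).hasCompactSupport
  obtain ⟨χ, h0, -, -, h1⟩ := exists_cutoff hK isOpen_univ (subset_univ _)
  refine ⟨⟨⟨fun p => (p.1 : ℝ) * χ p, by fun_prop⟩, χ.hasCompactSupport.mul_left⟩,
    fun p => mul_nonneg (le_of_lt p.1.2) (h0 p), fun p ⟨i, hi⟩ => ?_⟩
  change (p.1 : ℝ) ≤ p.1 * χ p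
  rw [h1 p (mem_iUnion.2 ⟨i, subset_tsupport _ hi⟩), mul_one]

omit [SecondCountableTopology X] [MeasurableSpace X] [BorelSpace X] in
theorem isDominated_incr (φ : ι → C_c(Marked X, ℝ)) (g : (ι → ℝ) →ᵇ ℝ)
    {B : (ι → ℝ) × Marked X → ι → ℝ} (hB : Continuous B)
    (h : ∀ q, (∀ i, φ i q.2 = 0) → B q = q.1) :
    IsDominated fun q : (ι → ℝ) × Marked X => (q.2.1 : ℝ) * (g (B q) - g q.1) := by
  obtain ⟨ω, h0, hω⟩ := exists_mass_bound φ
  refine ⟨by fun_prop, (2 * ‖g‖) • ω, fun q => ?_⟩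
  rw [CompactlySupportedContinuousMap.smul_apply, smul_eq_mul]
  change |(q.2.1 : ℝ) * (g (B q) - g q.1)| ≤ _
  by_cases hq : ∃ i, φ i q.2 ≠ 0
  · rw [abs_mul, abs_of_pos (show (0 : ℝ) < q.2.1 from q.2.1.2), mul_comm]
    refine mul_le_mul ?_ (hω q.2 hq) (le_of_lt q.2.1.2) (by positivity)
    exact g.dist_le_two_norm _ _
  · push Not at hq
    rw [h q hq, sub_self, mul_zero, abs_zero]
    exact mul_nonneg (by positivity) (h0 _)

omit [SecondCountableTopology X] [MeasurableSpace X] [BorelSpace X] in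
theorem isDominated_deathIncr (φ : ι → C_c(Marked X, ℝ)) (g : (ι → ℝ) →ᵇ ℝ) :
    IsDominated (deathIncr φ g) :=
  isDominated_incr φ g (by fun_prop) fun q hq => funext fun i => by simp [hq]

omit [SecondCountableTopology X] [MeasurableSpace X] [BorelSpace X] in
theorem isDominated_birthIncr (φ : ι → C_c(Marked X, ℝ)) (g : (ι → ℝ) →ᵇ ℝ) :
    IsDominated (birthIncr φ g) :=
  isDominated_incr φ g (by fun_prop) fun q hq => funext fun i => by simp [hq]

omit [T2Space X] [SecondCountableTopology X] [LocallyCompactSpace X] [MeasurableSpace X]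
  [BorelSpace X] in
theorem pairing_insert {γ γ' : Configuration (Marked X)} {p : Marked X} (hp : p ∉ γ.carrier)
    (h : γ'.carrier = insert p γ.carrier) (f : C_c(Marked X, ℝ)) :
    γ'.pairing f = γ.pairing f + f p := by
  have hs : Summable (f ∘ (Subtype.val : γ.carrier → Marked X)) := by
    refine summable_of_hasFiniteSupport (Set.Finite.of_finite_image (f := Subtype.val) ?_
      Subtype.val_injective.injOn)
    refine (γ.locallyFinite _ f.hasCompactSupport).subset ?_
    rintro _ ⟨y, hy, rfl⟩
    exact ⟨y.2, subset_tsupport _ hy⟩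
  rw [Configuration.pairing, h, ← union_singleton, Summable.tsum_union_disjoint
    (disjoint_singleton_right.2 hp) hs (Set.Finite.summable (finite_singleton p) _), tsum_singleton]
  rfl

open Classical in
omit [LocallyCompactSpace X] in
theorem remove_singleton (η : Cone X) (x y : X) :
    (η.remove x).toMeasure {y} = if y = x then 0 else η.toMeasure {y} := by
  change η.toMeasure.restrict {x}ᶜ {y} = _
  rw [Measure.restrict_apply (measurableSet_singleton y)]
  split_ifs with h
  · simp [h]
  · rw [inter_eq_left.2]
    simpa [eq_comm] using h

open Classical in
omit [LocallyCompactSpace X] in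
theorem add_singleton (η : Cone X) (s : Ioi (0 : ℝ)) (x y : X) :
    (η.add s x).toMeasure {y} =
      η.toMeasure {y} + if y = x then ENNReal.ofReal s else 0 := by
  change (η.toMeasure + ENNReal.ofReal s • Measure.dirac x) {y} = _
  rw [Measure.add_apply, Measure.smul_apply, smul_eq_mul]
  split_ifs with h
  · simp [h]
  · simp [Ne.symm h]

omit [LocallyCompactSpace X] in
/-- Removing the atom `p` from `η` removes `p` from its configuration of atoms. -/
theorem pairing_remove {η : Cone X} {p : Marked X} (hp : p ∈ η.atoms.carrier)
    (f : C_c(Marked X, ℝ)) : (η.remove p.2).atoms.pairing f = η.atoms.pairing f - f p := by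
  have hp' : η.toMeasure {p.2} = ENNReal.ofReal p.1 := hp
  rw [eq_sub_iff_add_eq]
  refine (pairing_insert ?_ ?_ f).symm
  · change ¬ (η.remove p.2).toMeasure {p.2} = ENNReal.ofReal p.1
    rw [remove_singleton, if_pos rfl]
    exact (ENNReal.ofReal_pos.2 p.1.2).ne
  · ext q
    change η.toMeasure {q.2} = ENNReal.ofReal q.1 ↔
      q = p ∨ (η.remove p.2).toMeasure {q.2} = ENNReal.ofReal q.1
    rw [remove_singleton]
    by_cases h : q.2 = p.2
    · rw [if_pos h, h, hp', ENNReal.ofReal_eq_ofReal_iff (le_of_lt p.1.2) (le_of_lt q.1.2)]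
      constructor
      · exact fun h1 => Or.inl (Prod.ext (Subtype.ext h1.symm) h)
      · rintro (rfl | h1)
        · rfl
        · exact absurd h1 (ENNReal.ofReal_pos.2 q.1.2).ne
    · rw [if_neg h]
      exact ⟨Or.inr, fun h1 => h1.resolve_left fun h2 => h (h2 ▸ rfl)⟩

omit [LocallyCompactSpace X] in
/-- Adding an atom at a point without mass adds it to the configuration of atoms; at a point with
mass the old atom would be replaced by a heavier one. -/
theorem pairing_cone_add {η : Cone X} {p : Marked X} (hp : η.toMeasure {p.2} = 0)
    (f : C_c(Marked X, ℝ)) : (η.add p.1 p.2).atoms.pairing f = η.atoms.pairing f + f p := by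
  refine pairing_insert ?_ ?_ f
  · change ¬ η.toMeasure {p.2} = ENNReal.ofReal p.1
    rw [hp]
    exact (ENNReal.ofReal_pos.2 p.1.2).ne
  · ext q
    change (η.add p.1 p.2).toMeasure {q.2} = ENNReal.ofReal q.1 ↔
      q = p ∨ η.toMeasure {q.2} = ENNReal.ofReal q.1
    rw [add_singleton]
    by_cases h : q.2 = p.2
    · rw [if_pos h, h, hp, zero_add,
        ENNReal.ofReal_eq_ofReal_iff (le_of_lt p.1.2) (le_of_lt q.1.2)]
      constructor
      · exact fun h1 => Or.inl (Prod.ext (Subtype.ext h1.symm) h)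
      · rintro (rfl | h1)
        · rfl
        · exact absurd h1 (ENNReal.ofReal_pos.2 q.1.2).ne
    · rw [if_neg h, add_zero]
      exact ⟨Or.inr, fun h1 => h1.resolve_left fun h2 => h (h2 ▸ rfl)⟩

omit [LocallyCompactSpace X] [Fintype ι] in
theorem mul_deathGrad_cyl (φ : ι → C_c(Marked X, ℝ)) (g : (ι → ℝ) →ᵇ ℝ) {η : Cone X}
    {p : Marked X} (hp : p ∈ η.atoms.carrier) :
    (p.1 : ℝ) * deathGrad (cyl φ g) η p.2 = deathIncr φ g (pairingVec φ η.atoms, p) := by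
  simp only [deathGrad, cyl, deathIncr]
  congr 3
  funext i
  exact pairing_remove hp (φ i)

/-- Integrals against `η` are sums over its atoms `(s, x)`, weighted by `s`. -/
theorem integrable_integral_of_atoms {η : Cone X} {u : X → ℝ} {Φ : Marked X → ℝ}
    (hΦ : Integrable Φ (countMeasure η.atoms))
    (h : ∀ p ∈ η.atoms.carrier, (p.1 : ℝ) * u p.2 = Φ p) :
    Integrable u η.toMeasure ∧ ∫ x, u x ∂η.toMeasure = ∫ p, Φ p ∂countMeasure η.atoms := by
  have hae := ae_countMeasure h
  have hi := (integrable_congr hae).2 hΦ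
  have hu := integrable_markedSum hi
  rw [show markedSum η.atoms.carrier = η.toMeasure from η.markedSum_atomSet] at hu
  exact ⟨hu, (integral_cone η hu).trans (integral_congr_ae hae)⟩

theorem integral_deathGrad_cyl (φ : ι → C_c(Marked X, ℝ)) (g : (ι → ℝ) →ᵇ ℝ) (η : Cone X) :
    Integrable (deathGrad (cyl φ g) η) η.toMeasure ∧
      ∫ x, deathGrad (cyl φ g) η x ∂η.toMeasure =
        ∫ p, deathIncr φ g (pairingVec φ η.atoms, p) ∂countMeasure η.atoms :=
  integrable_integral_of_atoms ((isDominated_deathIncr φ g).integrable_right _ _)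
    fun _ hp => mul_deathGrad_cyl φ g hp

/-- The integrand `s (g(v - φ) - g(v)) (h(v - φ) - h(v))` of the Dirichlet form. -/
def energyIncr (φ : ι → C_c(Marked X, ℝ)) (g h : (ι → ℝ) →ᵇ ℝ) (q : (ι → ℝ) × Marked X) : ℝ :=
  deathIncr φ g q * (h (fun i => q.1 i - φ i q.2) - h q.1)

omit [SecondCountableTopology X] [MeasurableSpace X] [BorelSpace X] in
theorem isDominated_energyIncr (φ : ι → C_c(Marked X, ℝ)) (g h : (ι → ℝ) →ᵇ ℝ) :
    IsDominated (energyIncr φ g h) :=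
  (isDominated_deathIncr φ g).mul_bounded (by fun_prop) fun _ => h.dist_le_two_norm _ _

theorem integral_deathGrad_mul_cyl (φ : ι → C_c(Marked X, ℝ)) (g h : (ι → ℝ) →ᵇ ℝ) (η : Cone X) :
    Integrable (fun x => deathGrad (cyl φ g) η x * deathGrad (cyl φ h) η x) η.toMeasure ∧
      ∫ x, deathGrad (cyl φ g) η x * deathGrad (cyl φ h) η x ∂η.toMeasure =
        ∫ p, energyIncr φ g h (pairingVec φ η.atoms, p) ∂countMeasure η.atoms := by
  refine integrable_integral_of_atoms ((isDominated_energyIncr φ g h).integrable_right _ _)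
    fun p hp => ?_
  have hne : (p.1 : ℝ) ≠ 0 := ne_of_gt p.1.2
  have h1 := mul_deathGrad_cyl φ h hp
  rw [← mul_assoc, mul_deathGrad_cyl φ g hp, energyIncr]
  rw [deathIncr] at h1
  rw [mul_left_cancel₀ hne h1]

variable {ν : Measure (Ioi (0 : ℝ))} [IsLocallyFiniteMeasure ν] {σ : Measure X}
  [IsLocallyFiniteMeasure σ] [NullSingletonClass σ]

omit [LocallyCompactSpace X] [IsLocallyFiniteMeasure ν] in
/-- As `σ` is non-atomic, a new atom is almost never put on an old one. -/
theorem ae_mass_eq_zero (η : Cone X) : ∀ᵐ p ∂ν.prod σ, η.toMeasure {p.2} = 0 := by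
  obtain ⟨S, hS, hS0⟩ := η.exists_countable
  have h0 : ν.prod σ (univ ×ˢ S) = 0 := by
    rw [Measure.prod_prod, hS.measure_zero, mul_zero]
  filter_upwards [compl_mem_ae_iff.2 h0] with p hp
  refine measure_mono_null (t := Sᶜ) (singleton_subset_iff.2 fun h => hp ⟨mem_univ _, h⟩) hS0

theorem integral_birthGrad_cyl (φ : ι → C_c(Marked X, ℝ)) (g : (ι → ℝ) →ᵇ ℝ) (η : Cone X) :
    Integrable (fun p => birthGrad (cyl φ g) η p * (p.1 : ℝ)) (ν.prod σ) ∧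
      ∫ x, ∫ s, birthGrad (cyl φ g) η (s, x) * (s : ℝ) ∂ν ∂σ =
        ∫ p, birthIncr φ g (pairingVec φ η.atoms, p) ∂ν.prod σ := by
  have hae : (fun p => birthGrad (cyl φ g) η p * (p.1 : ℝ)) =ᵐ[ν.prod σ]
      fun p => birthIncr φ g (pairingVec φ η.atoms, p) := by
    filter_upwards [ae_mass_eq_zero η] with p hp
    simp only [birthGrad, cyl, birthIncr]
    rw [mul_comm]
    congr 3
    funext i
    exact pairing_cone_add hp (φ i)
  have hi : Integrable (fun p => birthGrad (cyl φ g) η p * (p.1 : ℝ)) (ν.prod σ) :=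
    (integrable_congr hae).2 ((isDominated_birthIncr φ g).integrable_right _ _)
  refine ⟨hi, ?_⟩
  rw [← integral_congr_ae hae, integral_prod_symm _ hi]

/-- On cylinder functions the operator depends on `η` only through the configuration of its atoms.
-/
theorem birthDeath_cyl (φ : ι → C_c(Marked X, ℝ)) (g : (ι → ℝ) →ᵇ ℝ) (η : Cone X) :
    birthDeath ν σ (cyl φ g) η =
      ∫ p, deathIncr φ g (pairingVec φ η.atoms, p) ∂countMeasure η.atoms +
        ∫ p, birthIncr φ g (pairingVec φ η.atoms, p) ∂ν.prod σ := by
  rw [birthDeath, (integral_deathGrad_cyl φ g η).2, (integral_birthGrad_cyl φ g η).2]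

variable {π : Measure (Configuration (Marked X))}

omit [NullSingletonClass σ] in
/-- Integration by parts for the Poisson measure: by the Mecke identity, the part of the energy
with `h(v - φ)` turns into the birth part of the operator. -/
theorem IsPoissonMeasure.integral_energyIncr (hπ : IsPoissonMeasure (ν.prod σ) π)
    (φ : ι → C_c(Marked X, ℝ)) (g h : (ι → ℝ) →ᵇ ℝ) :
    ∫ γ, ∫ p, energyIncr φ g h (pairingVec φ γ, p) ∂countMeasure γ ∂π =
      ∫ γ, -(∫ p, deathIncr φ g (pairingVec φ γ, p) ∂countMeasure γ +
        ∫ p, birthIncr φ g (pairingVec φ γ, p) ∂ν.prod σ) * h (pairingVec φ γ) ∂π := by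
  have := hπ.isProbabilityMeasure
  have hd := isDominated_deathIncr φ g
  have hA : IsDominated fun q => deathIncr φ g q * h (fun i => q.1 i - φ i q.2) :=
    hd.mul_bounded (by fun_prop) fun q => h.norm_coe_le_norm _
  have hA' : IsDominated fun q => deathIncr φ g q * h q.1 :=
    hd.mul_bounded (by fun_prop) fun q => h.norm_coe_le_norm _
  have hB : IsDominated fun q => birthIncr φ g q * h q.1 :=
    (isDominated_birthIncr φ g).mul_bounded (by fun_prop) fun q => h.norm_coe_le_norm _
  have h1 : ∀ γ, ∫ p, energyIncr φ g h (pairingVec φ γ, p) ∂countMeasure γ =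
      ∫ p, deathIncr φ g (pairingVec φ γ, p) * h (fun i => pairingVec φ γ i - φ i p)
        ∂countMeasure γ -
      ∫ p, deathIncr φ g (pairingVec φ γ, p) * h (pairingVec φ γ) ∂countMeasure γ := fun γ => by
    rw [← integral_sub (hA.integrable_right _ _) (hA'.integrable_right _ _)]
    refine integral_congr_ae (Eventually.of_forall fun p => ?_)
    simp only [energyIncr]
    ring
  have h2 : ∀ γ, ∫ p, deathIncr φ g (fun i => pairingVec φ γ i + φ i p, p) *
      h (fun i => pairingVec φ γ i + φ i p - φ i p) ∂ν.prod σ =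
      -∫ p, birthIncr φ g (pairingVec φ γ, p) * h (pairingVec φ γ) ∂ν.prod σ := fun γ => by
    rw [← integral_neg]
    refine integral_congr_ae (Eventually.of_forall fun p => ?_)
    simp only [deathIncr, birthIncr, add_sub_cancel_right]
    ring
  simp_rw [h1]
  rw [integral_sub ((hA.memLp_count hπ φ).integrable one_le_two)
    ((hA'.memLp_count hπ φ).integrable one_le_two), hA.integral_mecke hπ φ]
  simp_rw [h2]
  rw [integral_neg, ← neg_add', ← integral_add ((hB.memLp_intensity hπ φ).integrable one_le_two)
    ((hA'.memLp_count hπ φ).integrable one_le_two), ← integral_neg]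
  refine integral_congr_ae (Eventually.of_forall fun γ => ?_)
  simp only [integral_mul_const]
  ring

end Cylinder

/-! ### The birth-and-death operator in `L²` -/

section Operator

variable {X : Type*} [TopologicalSpace X] [T2Space X] [SecondCountableTopology X]
  [LocallyCompactSpace X] [MeasurableSpace X] [BorelSpace X]

theorem measurable_cyl {ι : Type*} [Fintype ι] (φ : ι → C_c(Marked X, ℝ)) (g : (ι → ℝ) →ᵇ ℝ) :
    Measurable (cyl φ g) :=
  g.continuous.measurable.comp ((measurable_pairingVec φ).comp measurable_atoms)

theorem memLp_of_mem_cylinder (μ : Measure (Cone X)) [IsFiniteMeasure μ] (p : ℝ≥0∞)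
    {F : Cone X → ℝ} (hF : F ∈ cylinder X) : MemLp F p μ := by
  obtain ⟨N, φ, g, rfl⟩ := mem_cylinder_iff.1 hF
  exact MemLp.of_bound (measurable_cyl φ g).aestronglyMeasurable ‖g‖
    (Eventually.of_forall fun η => g.norm_coe_le_norm _)

theorem add_mem_cylinder {F G : Cone X → ℝ} (hF : F ∈ cylinder X) (hG : G ∈ cylinder X) :
    F + G ∈ cylinder X := by
  obtain ⟨N, φ, g, h, rfl, rfl⟩ := exists_common_cyl hF hG
  exact cyl_mem_cylinder φ (g + h)

theorem smul_mem_cylinder (c : ℝ) {F : Cone X → ℝ} (hF : F ∈ cylinder X) :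
    c • F ∈ cylinder X := by
  obtain ⟨N, φ, g, rfl⟩ := mem_cylinder_iff.1 hF
  exact cyl_mem_cylinder φ (c • g)

theorem zero_mem_cylinder : (0 : Cone X → ℝ) ∈ cylinder X :=
  cyl_mem_cylinder (Fin.elim0 : Fin 0 → C_c(Marked X, ℝ)) 0

/-- Finite measures on the cone are determined by the integrals of cylinder functions: these
determine the joint laws of finitely many functionals `⟨ℛ⁻¹η, φ⟩`, hence that of all of them. -/
theorem ext_of_integral_cylinder {μ₁ μ₂ : Measure (Cone X)} [IsFiniteMeasure μ₁]
    [IsFiniteMeasure μ₂] (h : ∀ F ∈ cylinder X, ∫ η, F η ∂μ₁ = ∫ η, F η ∂μ₂) : μ₁ = μ₂ := by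
  let T : Cone X → C_c(Marked X, ℝ) → ℝ := fun η φ => η.atoms.pairing φ
  have hT : Measurable T :=
    measurable_pi_lambda _ fun φ => (measurable_pairing φ).comp measurable_atoms
  have hfd : ∀ J : Finset C_c(Marked X, ℝ),
      (μ₁.map T).map J.restrict = (μ₂.map T).map J.restrict := fun J => by
    have hJ : Measurable (J.restrict (π := fun _ : C_c(Marked X, ℝ) => ℝ)) := J.measurable_restrict
    rw [Measure.map_map hJ hT, Measure.map_map hJ hT]
    refine ext_of_forall_integral_eq_of_IsFiniteMeasure fun g => ?_
    rw [integral_map (hJ.comp hT).aemeasurable g.continuous.measurable.aestronglyMeasurable,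
      integral_map (hJ.comp hT).aemeasurable g.continuous.measurable.aestronglyMeasurable]
    exact h _ (cyl_mem_cylinder (fun φ : J => (φ : C_c(Marked X, ℝ))) g)
  have hmap : μ₁.map T = μ₂.map T :=
    IsProjectiveLimit.unique (P := fun J => (μ₂.map T).map J.restrict) hfd fun _ => rfl
  refine Measure.ext fun A hA => ?_
  obtain ⟨B, hB, rfl⟩ := measurableSpace_cone_le_comap A hA
  rw [← Measure.map_apply hT hB, ← Measure.map_apply hT hB, hmap]

/-- An integrable function that is orthogonal to all cylinder functions vanishes: its positive and
negative parts are densities of measures with the same integrals of cylinder functions. -/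
theorem ae_eq_zero_of_integral_cylinder {μ : Measure (Cone X)} [IsFiniteMeasure μ]
    {u : Cone X → ℝ} (hu : Integrable u μ) (h : ∀ F ∈ cylinder X, ∫ η, u η * F η ∂μ = 0) :
    u =ᵐ[μ] 0 := by
  have hm1 : AEMeasurable (fun η => ENNReal.ofReal (u η)) μ := hu.1.aemeasurable.ennreal_ofReal
  have hm2 : AEMeasurable (fun η => ENNReal.ofReal (-u η)) μ :=
    hu.1.aemeasurable.neg.ennreal_ofReal
  have : IsFiniteMeasure (μ.withDensity fun η => ENNReal.ofReal (u η)) :=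
    isFiniteMeasure_withDensity_ofReal hu.2
  have : IsFiniteMeasure (μ.withDensity fun η => ENNReal.ofReal (-u η)) :=
    isFiniteMeasure_withDensity_ofReal hu.neg.2
  have key : (μ.withDensity fun η => ENNReal.ofReal (u η)) =
      μ.withDensity fun η => ENNReal.ofReal (-u η) := by
    refine ext_of_integral_cylinder fun F hF => ?_
    rw [integral_withDensity_eq_integral_toReal_smul₀ hm1
        (Eventually.of_forall fun _ => ENNReal.ofReal_lt_top),
      integral_withDensity_eq_integral_toReal_smul₀ hm2
        (Eventually.of_forall fun _ => ENNReal.ofReal_lt_top), ← sub_eq_zero, ← integral_sub]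
    · rw [← h F hF]
      refine integral_congr_ae (Eventually.of_forall fun η => ?_)
      simp only [ENNReal.toReal_ofReal', smul_eq_mul, ← sub_mul]
      congr 1
      exact max_zero_sub_eq_self (u η)
    · exact (hu.pos_part.congr (Eventually.of_forall fun η => by
        simp [ENNReal.toReal_ofReal'])).mul_of_top_left (memLp_of_mem_cylinder μ ∞ hF)
    · exact (hu.neg.pos_part.congr (Eventually.of_forall fun η => by
        simp [ENNReal.toReal_ofReal'])).mul_of_top_left (memLp_of_mem_cylinder μ ∞ hF)
  rw [withDensity_eq_iff hm1 hm2 hu.lintegral_lt_top.ne] at key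
  filter_upwards [key] with η hη
  rcases le_total (u η) 0 with h0 | h0
  · rw [ENNReal.ofReal_of_nonpos h0, eq_comm, ENNReal.ofReal_eq_zero] at hη
    exact le_antisymm h0 (neg_nonpos.1 hη)
  · rw [ENNReal.ofReal_of_nonpos (neg_nonpos.2 h0), ENNReal.ofReal_eq_zero] at hη
    exact le_antisymm hη h0

/-- The `μ`-classes of cylinder functions. -/
def cylinderClasses (μ : Measure (Cone X)) : Submodule ℝ (Lp ℝ 2 μ) where
  carrier := {u | ∃ F ∈ cylinder X, u =ᵐ[μ] F}
  add_mem' := by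
    rintro u v ⟨F, hF, hu⟩ ⟨G, hG, hv⟩
    exact ⟨F + G, add_mem_cylinder hF hG, (Lp.coeFn_add u v).trans (hu.add hv)⟩
  zero_mem' := ⟨0, zero_mem_cylinder, Lp.coeFn_zero _ _ _⟩
  smul_mem' := by
    rintro c u ⟨F, hF, hu⟩
    exact ⟨c • F, smul_mem_cylinder c hF, (Lp.coeFn_smul c u).trans (hu.const_smul c)⟩

omit [T2Space X] [SecondCountableTopology X] [LocallyCompactSpace X] [BorelSpace X] in
theorem inner_eq_integral {μ : Measure (Cone X)} {u v : Lp ℝ 2 μ} {F G : Cone X → ℝ}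
    (hu : u =ᵐ[μ] F) (hv : v =ᵐ[μ] G) : ⟪u, v⟫_ℝ = ∫ η, F η * G η ∂μ := by
  rw [L2.inner_def]
  refine integral_congr_ae ?_
  filter_upwards [hu, hv] with η h1 h2
  simp [h1, h2, mul_comm]

theorem dense_cylinderClasses (μ : Measure (Cone X)) [IsFiniteMeasure μ] :
    Dense (cylinderClasses μ : Set (Lp ℝ 2 μ)) := by
  rw [Submodule.dense_iff_topologicalClosure_eq_top, Submodule.topologicalClosure_eq_top_iff,
    Submodule.eq_bot_iff]
  intro u hu
  refine (Lp.eq_zero_iff_ae_eq_zero).2 (ae_eq_zero_of_integral_cylinder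
    ((Lp.memLp u).integrable one_le_two) fun F hF => ?_)
  have hF2 := memLp_of_mem_cylinder μ 2 hF
  rw [← inner_eq_integral (ae_eq_refl u) hF2.coeFn_toLp]
  exact (Submodule.mem_orthogonal' _ u).1 hu _ ⟨F, hF, hF2.coeFn_toLp⟩

variable {ν : Measure (Ioi (0 : ℝ))} [IsLocallyFiniteMeasure ν] {σ : Measure X}
  [IsLocallyFiniteMeasure σ] [NullSingletonClass σ]

theorem birthDeath_add {F G : Cone X → ℝ} (hF : F ∈ cylinder X) (hG : G ∈ cylinder X) :
    birthDeath ν σ (F + G) = birthDeath ν σ F + birthDeath ν σ G := by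
  obtain ⟨N, φ, g, h, rfl, rfl⟩ := exists_common_cyl hF hG
  have hd : ∀ q, deathIncr φ (g + h) q = deathIncr φ g q + deathIncr φ h q := fun q => by
    simp only [deathIncr, BoundedContinuousFunction.add_apply]
    ring
  have hb : ∀ q, birthIncr φ (g + h) q = birthIncr φ g q + birthIncr φ h q := fun q => by
    simp only [birthIncr, BoundedContinuousFunction.add_apply]
    ring
  funext η
  change birthDeath ν σ (cyl φ (g + h)) η = _ + _
  simp_rw [birthDeath_cyl, hd, hb]
  rw [integral_add ((isDominated_deathIncr φ g).integrable_right _ _)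
      ((isDominated_deathIncr φ h).integrable_right _ _),
    integral_add ((isDominated_birthIncr φ g).integrable_right _ _)
      ((isDominated_birthIncr φ h).integrable_right _ _)]
  ring

omit [T2Space X] [SecondCountableTopology X] [LocallyCompactSpace X] [BorelSpace X]
  [IsLocallyFiniteMeasure ν] [IsLocallyFiniteMeasure σ] [NullSingletonClass σ] in
theorem birthDeath_smul [MeasurableSingletonClass X] (c : ℝ) (F : Cone X → ℝ) :
    birthDeath ν σ (c • F) = c • birthDeath ν σ F := by
  funext η
  simp only [birthDeath, deathGrad, birthGrad, Pi.smul_apply, smul_eq_mul, ← mul_sub, mul_assoc,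
    integral_const_mul, mul_add]

variable {π : Measure (Configuration (Marked X))} {μ : Measure (Cone X)}

theorem memLp_birthDeath (hπ : IsPoissonMeasure (ν.prod σ) π)
    (hμ : MeasurePreserving Cone.atoms μ π) {F : Cone X → ℝ} (hF : F ∈ cylinder X) :
    MemLp (birthDeath ν σ F) 2 μ := by
  obtain ⟨N, φ, g, rfl⟩ := mem_cylinder_iff.1 hF
  refine MemLp.ae_eq (Eventually.of_forall fun η => (birthDeath_cyl φ g η).symm)
    (MemLp.comp_measurePreserving (((isDominated_deathIncr φ g).memLp_count hπ φ).add
      ((isDominated_birthIncr φ g).memLp_intensity hπ φ)) hμ)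

omit [NullSingletonClass σ] in
theorem integrable_integral_deathGrad_mul (hπ : IsPoissonMeasure (ν.prod σ) π)
    (hμ : MeasurePreserving Cone.atoms μ π) {F G : Cone X → ℝ} (hF : F ∈ cylinder X)
    (hG : G ∈ cylinder X) :
    Integrable (fun η => ∫ x, deathGrad F η x * deathGrad G η x ∂η.toMeasure) μ := by
  have := hπ.isProbabilityMeasure
  obtain ⟨N, φ, g, h, rfl, rfl⟩ := exists_common_cyl hF hG
  simp_rw [(integral_deathGrad_mul_cyl φ g h _).2]
  exact hμ.integrable_comp_of_integrable
    (((isDominated_energyIncr φ g h).memLp_count hπ φ).integrable one_le_two)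

omit [SecondCountableTopology X] [LocallyCompactSpace X] in
theorem integral_comp_atoms (hμ : MeasurePreserving Cone.atoms μ π)
    {f : Configuration (Marked X) → ℝ} (hf : AEStronglyMeasurable f π) :
    ∫ η, f η.atoms ∂μ = ∫ γ, f γ ∂π := by
  rw [← hμ.map_eq] at hf ⊢
  rw [integral_map hμ.measurable.aemeasurable hf]

/-- Integration by parts on the cone. -/
theorem dirichletForm_eq (hπ : IsPoissonMeasure (ν.prod σ) π)
    (hμ : MeasurePreserving Cone.atoms μ π) {F G : Cone X → ℝ} (hF : F ∈ cylinder X)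
    (hG : G ∈ cylinder X) :
    dirichletForm μ F G = ∫ η, -birthDeath ν σ F η * G η ∂μ := by
  obtain ⟨N, φ, g, h, rfl, rfl⟩ := exists_common_cyl hF hG
  have hd := (isDominated_deathIncr φ g).memLp_count hπ φ
  have hb := (isDominated_birthIncr φ g).memLp_intensity hπ φ
  rw [dirichletForm]
  simp_rw [(integral_deathGrad_mul_cyl φ g h _).2, birthDeath_cyl, cyl]
  rw [integral_comp_atoms hμ (f := fun γ =>
      ∫ p, energyIncr φ g h (pairingVec φ γ, p) ∂countMeasure γ)
      ((isDominated_energyIncr φ g h).memLp_count hπ φ).1,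
    integral_comp_atoms hμ (f := fun γ =>
      -(∫ p, deathIncr φ g (pairingVec φ γ, p) ∂countMeasure γ +
        ∫ p, birthIncr φ g (pairingVec φ γ, p) ∂ν.prod σ) * h (pairingVec φ γ))
      ((hd.1.add hb.1).neg.mul
        (h.continuous.measurable.comp (measurable_pairingVec φ)).aestronglyMeasurable),
    hπ.integral_energyIncr φ g h]

omit [T2Space X] [SecondCountableTopology X] [LocallyCompactSpace X] [BorelSpace X] in
theorem dirichletForm_comm [MeasurableSingletonClass X] (μ : Measure (Cone X))
    (F G : Cone X → ℝ) : dirichletForm μ F G = dirichletForm μ G F := by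
  simp_rw [dirichletForm, mul_comm]

/-- The birth-and-death operator respects `μ`-classes: `LH` is orthogonal to every cylinder function
`G` if `H = 0`, as `⟨LH, G⟩ = ⟨H, LG⟩`. -/
theorem birthDeath_ae_eq_zero (hπ : IsPoissonMeasure (ν.prod σ) π)
    (hμ : MeasurePreserving Cone.atoms μ π) [IsFiniteMeasure μ] {F : Cone X → ℝ}
    (hF : F ∈ cylinder X) (h0 : F =ᵐ[μ] 0) : birthDeath ν σ F =ᵐ[μ] 0 := by
  refine ae_eq_zero_of_integral_cylinder ((memLp_birthDeath hπ hμ hF).integrable one_le_two)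
    fun G hG => ?_
  have h1 : ∫ η, -birthDeath ν σ F η * G η ∂μ = 0 := by
    rw [← dirichletForm_eq hπ hμ hF hG, dirichletForm_comm, dirichletForm_eq hπ hμ hG hF]
    refine integral_eq_zero_of_ae ?_
    filter_upwards [h0] with η hη
    simp [hη]
  simpa [integral_neg] using h1

theorem birthDeath_congr_ae (hπ : IsPoissonMeasure (ν.prod σ) π)
    (hμ : MeasurePreserving Cone.atoms μ π) [IsFiniteMeasure μ] {F G : Cone X → ℝ}
    (hF : F ∈ cylinder X) (hG : G ∈ cylinder X) (h : F =ᵐ[μ] G) :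
    birthDeath ν σ F =ᵐ[μ] birthDeath ν σ G := by
  have hG' := smul_mem_cylinder (-1) hG
  have h0 : F + (-1 : ℝ) • G =ᵐ[μ] 0 := by
    filter_upwards [h] with η hη
    simp [hη]
  have := birthDeath_ae_eq_zero hπ hμ (add_mem_cylinder hF hG') h0
  rw [birthDeath_add hF hG', birthDeath_smul] at this
  filter_upwards [this] with η hη
  simpa [← sub_eq_add_neg, sub_eq_zero] using hη

/-- The birth-and-death operator on `μ`-classes of cylinder functions. -/
theorem exists_operator (hπ : IsPoissonMeasure (ν.prod σ) π)
    (hμ : MeasurePreserving Cone.atoms μ π) [IsFiniteMeasure μ] :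
    ∃ L : Lp ℝ 2 μ →ₗ.[ℝ] Lp ℝ 2 μ, L.domain = cylinderClasses μ ∧
      ∀ u : L.domain, ∀ F ∈ cylinder X, (u : Lp ℝ 2 μ) =ᵐ[μ] F →
        L u =ᵐ[μ] birthDeath ν σ F := by
  have hD : ∀ u : cylinderClasses μ, ∃ F ∈ cylinder X, (u : Lp ℝ 2 μ) =ᵐ[μ] F := fun u => u.2
  choose R hR huR using hD
  have key : ∀ u : cylinderClasses μ, ∀ F ∈ cylinder X, (u : Lp ℝ 2 μ) =ᵐ[μ] F →
      (memLp_birthDeath hπ hμ (hR u)).toLp =ᵐ[μ] birthDeath ν σ F := fun u F hF hu =>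
    (MemLp.coeFn_toLp _).trans (birthDeath_congr_ae hπ hμ (hR u) hF ((huR u).symm.trans hu))
  refine ⟨⟨cylinderClasses μ,
    { toFun := fun u => (memLp_birthDeath hπ hμ (hR u)).toLp
      map_add' := fun u v => Lp.ext ?_
      map_smul' := fun c u => Lp.ext ?_ }⟩, rfl, key⟩
  · have h1 := key (u + v) _ (add_mem_cylinder (hR u) (hR v))
      ((Lp.coeFn_add (u : Lp ℝ 2 μ) v).trans ((huR u).add (huR v)))
    rw [birthDeath_add (hR u) (hR v)] at h1
    exact h1.trans (((key u _ (hR u) (huR u)).add (key v _ (hR v) (huR v))).symm.trans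
      (Lp.coeFn_add _ _).symm)
  · have h1 := key (c • u) _ (smul_mem_cylinder c (hR u))
      ((Lp.coeFn_smul c (u : Lp ℝ 2 μ)).trans ((huR u).const_smul c))
    rw [birthDeath_smul] at h1
    exact h1.trans (((key u _ (hR u) (huR u)).const_smul c).symm.trans (Lp.coeFn_smul _ _).symm)

end Operator

end ConeCalculus

end

theorem mainTheorem3 {X : Type*} [TopologicalSpace X] [PolishSpace X] [LocallyCompactSpace X]
    [MeasurableSpace X] [BorelSpace X]
    (ν : Measure (Ioi (0 : ℝ))) [IsLocallyFiniteMeasure ν] [NullSingletonClass ν]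
    (hν : ∫⁻ s, ENNReal.ofReal (s : ℝ) ∂ν < ∞)
    (σ : Measure X) [IsLocallyFiniteMeasure σ] [NullSingletonClass σ]
    (π : Measure (ConeCalculus.Configuration (ConeCalculus.Marked X)))
    (hπ : ConeCalculus.IsPoissonMeasure (ν.prod σ) π)
    (μ : Measure (ConeCalculus.Cone X)) (hμ : μ = ConeCalculus.coneMeasure π) :
    IsProbabilityMeasure μ ∧
    -- the objects in the definitions of `LF` and `ℰ(F, G)` exist, and `LF ∈ L²`
    (∀ F ∈ ConeCalculus.cylinder X,
      MemLp F 2 μ ∧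
      (∀ η : ConeCalculus.Cone X,
        Integrable (ConeCalculus.deathGrad F η) η.toMeasure ∧
        Integrable (fun p => ConeCalculus.birthGrad F η p * (p.1 : ℝ)) (ν.prod σ)) ∧
      MemLp (ConeCalculus.birthDeath ν σ F) 2 μ) ∧
    (∀ F ∈ ConeCalculus.cylinder X, ∀ G ∈ ConeCalculus.cylinder X,
      (∀ η : ConeCalculus.Cone X, Integrable
        (fun x => ConeCalculus.deathGrad F η x * ConeCalculus.deathGrad G η x) η.toMeasure) ∧
      Integrable (fun η : ConeCalculus.Cone X =>
        ∫ x, ConeCalculus.deathGrad F η x * ConeCalculus.deathGrad G η x ∂η.toMeasure) μ ∧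
      ConeCalculus.dirichletForm μ F G = ∫ η, -ConeCalculus.birthDeath ν σ F η * G η ∂μ) ∧
    -- the operator `(L, 𝓕)` and the form `(ℰ, 𝓕)` on `L²(𝕂(X), μ)`
    ∃ (L : Lp ℝ 2 μ →ₗ.[ℝ] Lp ℝ 2 μ) (E : ConeCalculus.PartialForm (Lp ℝ 2 μ)),
      (∀ u : Lp ℝ 2 μ, u ∈ L.domain ↔ ∃ F ∈ ConeCalculus.cylinder X, u =ᵐ[μ] F) ∧
      (∀ u : L.domain, ∀ F ∈ ConeCalculus.cylinder X, (u : Lp ℝ 2 μ) =ᵐ[μ] F →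
        L u =ᵐ[μ] ConeCalculus.birthDeath ν σ F) ∧
      (∀ u : Lp ℝ 2 μ, u ∈ E.domain ↔ ∃ F ∈ ConeCalculus.cylinder X, u =ᵐ[μ] F) ∧
      (∀ u v : E.domain, ∀ F ∈ ConeCalculus.cylinder X, ∀ G ∈ ConeCalculus.cylinder X,
        (u : Lp ℝ 2 μ) =ᵐ[μ] F → (v : Lp ℝ 2 μ) =ᵐ[μ] G →
        E.form u v = ConeCalculus.dirichletForm μ F G) ∧
      -- `(L, 𝓕)` is symmetric and `ℰ(u, v) = ⟨-Lu, v⟩`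
      Dense (L.domain : Set (Lp ℝ 2 μ)) ∧
      L.IsFormalAdjoint L ∧
      (∀ (u : L.domain) (u' v : E.domain), (u : Lp ℝ 2 μ) = u' →
        E.form u' v = ⟪-L u, (v : Lp ℝ 2 μ)⟫_ℝ) ∧
      -- `(ℰ, 𝓕)` is closable; the Friedrichs extension of `(L, 𝓕)` generates the closure of `ℰ`
      E.IsSymmNonneg ∧
      E.IsClosable ∧
      ∃ (Lbar : Lp ℝ 2 μ →ₗ.[ℝ] Lp ℝ 2 μ) (Ebar : ConeCalculus.PartialForm (Lp ℝ 2 μ)),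
        ConeCalculus.IsFriedrichsExtension (-L) (-Lbar) ∧
        Ebar.IsClosureOf E ∧
        Ebar.IsClosed ∧
        Ebar.IsSymmNonneg ∧
        Ebar.IsGenerator Lbar := by
  open ConeCalculus in
  have hA : MeasurePreserving Cone.atoms μ π := hμ ▸ hπ.measurePreserving_atoms hν
  have := hπ.isProbabilityMeasure
  have hprob : IsProbabilityMeasure μ := by
    refine ⟨?_⟩
    rw [← preimage_univ (f := Cone.atoms), hA.measure_preimage nullMeasurableSet_univ, measure_univ]
  obtain ⟨L, hdom, hL⟩ := exists_operator hπ hA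
  have hmem : ∀ u : Lp ℝ 2 μ, u ∈ L.domain ↔ ∃ F ∈ cylinder X, u =ᵐ[μ] F := fun u => by
    rw [hdom]
    rfl
  have hform : ∀ u v : L.domain, ∀ F ∈ cylinder X, ∀ G ∈ cylinder X,
      (u : Lp ℝ 2 μ) =ᵐ[μ] F → (v : Lp ℝ 2 μ) =ᵐ[μ] G →
      ⟪-L u, (v : Lp ℝ 2 μ)⟫_ℝ = dirichletForm μ F G := fun u v F hF G hG hu hv => by
    rw [dirichletForm_eq hπ hA hF hG]
    exact inner_eq_integral ((Lp.coeFn_neg _).trans (hL u F hF hu).neg) hv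
  have hdense : Dense (L.domain : Set (Lp ℝ 2 μ)) := hdom ▸ dense_cylinderClasses μ
  -- symmetry of `L` is that of the Dirichlet form
  have hneg : (-L).IsFormalAdjoint (-L) := fun u v => by
    obtain ⟨F, hF, hu⟩ := (hmem u).1 u.2
    obtain ⟨G, hG, hv⟩ := (hmem v).1 v.2
    change ⟪-L u, (v : Lp ℝ 2 μ)⟫_ℝ = ⟪(u : Lp ℝ 2 μ), -L v⟫_ℝ
    rw [← real_inner_comm, real_inner_comm, hform u v F hF G hG hu hv, real_inner_comm,
      hform v u G hG F hF hv hu, dirichletForm_comm]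
  have hnonneg : ∀ u : (-L).domain, 0 ≤ ⟪(-L) u, (u : Lp ℝ 2 μ)⟫_ℝ := fun u => by
    obtain ⟨F, hF, hu⟩ := (hmem u).1 u.2
    refine (hform u u F hF F hF hu hu).symm ▸ integral_nonneg fun η => integral_nonneg fun x => ?_
    exact mul_self_nonneg _
  obtain ⟨hsn, hcl, B, r, hB, hr⟩ := exists_isFriedrichsExtension (A := -L) hdense hneg hnonneg
  refine ⟨hprob, fun F hF => ⟨memLp_of_mem_cylinder μ 2 hF, fun η => ?_, memLp_birthDeath hπ hA hF⟩,
    fun F hF G hG => ⟨fun η => ?_, integrable_integral_deathGrad_mul hπ hA hF hG,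
      dirichletForm_eq hπ hA hF hG⟩,
    L, operatorForm (-L), hmem, hL, hmem, hform, hdense, fun u v => ?_, ?_, hsn, hcl, -B, r, ?_⟩
  · obtain ⟨N, φ, g, rfl⟩ := mem_cylinder_iff.1 hF
    exact ⟨(integral_deathGrad_cyl φ g η).1, (integral_birthGrad_cyl φ g η).1⟩
  · obtain ⟨N, φ, g, h, rfl, rfl⟩ := exists_common_cyl hF hG
    exact (integral_deathGrad_mul_cyl φ g h η).1
  · have h := hneg u v
    change ⟪-L u, (v : Lp ℝ 2 μ)⟫_ℝ = ⟪(u : Lp ℝ 2 μ), -L v⟫_ℝ at h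
    rwa [inner_neg_left, inner_neg_right, neg_inj] at h
  · intro u u' v huv
    obtain rfl : u = u' := Subtype.ext huv
    rfl
  · rw [neg_neg]
    exact ⟨hB, hr⟩
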